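/- Let $X\in\mathbb R^{d\times T}$ and $Y_{\mathrm{full}}\in\mathbb R^{d\times T_{tot}}$ with $T<T_{tot}$, let $Y\in\mathbb R^{d\times T}$ consist of the first $T$ columns of $Y_{\mathrm{full}}$, let $r\ge 0$, and let $\xi,\lambda,\lambda_1,\lambda_2\ge 0$. For $H\in\mathbb R^{r\times n}$ put $\widehat H[s,k]=\frac1n\sum_{f=0}^{n-1}H[s,f]e^{-2\pi i fk/n}$; for $K\subseteq\{0,\dots,n-1\}$ let $\mathcal G=\{H: H\ge 0\text{ entrywise}\}$ and $\mathcal H_K=\{H:\widehat H[s,k]=0\text{ for all } s \text{ and all } k\notin K\}$. Fix $K\subseteq\{0,\dots,T-1\}$ and $K_{tot}\subseteq\{0,\dots,T_{tot}-1\}$, and consider the hard-constrained problem $$\min\ \|X-WH\|_F^2+\xi\|Y-W'H\|_F^2+\lambda\|H\|_F^2+\lambda_1\|W\|_F^2+\lambda_2\|W'\|_F^2\quad\text{over } W,W'\in\mathbb R^{d\times r},\ H\in\mathcal G\cap\mathcal H_K \qquad (P)$$ (the weights $\lambda=\lambda_1=\lambda_2=0$ are allowed and give the unregularized problem). A feasible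 point is stationary for $(P)$ if the directional derivative of the objective towards every other feasible point is nonnegative. Three operator splitting (TOS) for a differentiable $f$ and a frequency set $K$, started at $y_0$, is $$H_j=P_{\mathcal G}(y_j),\quad G_j=P_{\mathcal H_K}\bigl(2H_j-y_j-\gamma_j\nabla f(H_j)\bigr),\quad y_{j+1}=y_j-H_j+G_j,\quad \gamma_j=\Bigl(\sum_{\tau<j}\|\nabla f(H_\tau)\|_F^2\Bigr)^{-1/2},$$ where $P$ denotes the Frobenius-orthogonal projection and $\gamma_j>0$ is arbitrary as long as the sum is $0$; it outputs the limit of the ergodic sequence $\overline H_n=\frac1{n+1}\sum_{\tau=0}^nH_\tau$. The alternating scheme takes arbitrary $H_0,W_0,W'_0$ and, for $j\ge1$, lets $H_j$ be an output of TOS (from any starting point) for $f(H)=\|X-W_{j-1}H\|_F^2+\xi\|Y-W'_{j-1}H\|_F^2+\lambda\|H\|_F^2$ and $K$, lets $W_j$ be a minimizer of $\|X-WH_j\|_F^2+\lambda_1\|W\|_F^2$, and lets $W'_j$ be a minimizer of $\xi\|Y-W'H_j\|_F^2+\lambda_2\|W'\|_F^2$. Then: 1. For all $W,W'$, every starting point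 and every TOS run for $f(H)=\|X-WH\|_F^2+\xi\|Y-W'H\|_F^2+\lambda\|H\|_F^2$ and $K$, the ergodic sequence converges to a minimizer of $f$ over $\mathcal G\cap\mathcal H_K$. The same holds for the encoding problem over the whole period, i.e. for $f(H)=\|Y_{\mathrm{full}}-W'H\|_F^2$, $H\in\mathbb R^{r\times T_{tot}}$, and $K_{tot}$. In particular, TOS runs exist from every starting point, and iterates $(H_j,W_j,W'_j)$ of the alternating scheme exist for every initialization. 2. Every cluster point of $(H_j,W_j,W'_j)$ is a stationary point of $(P)$. 3. If $(H_j,W_j,W'_j)$ is bounded, its distance to the set of stationary points of $(P)$ tends to $0$. 4. If $\lambda,\lambda_1,\lambda_2>0$, then $(H_j,W_j,W'_j)$ is bounded, so that its distance to the set of stationary points of $(P)$ tends to $0$. -/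

import Mathlib

open Filter Topology

namespace SSNMF

noncomputable section

/-- The squared Frobenius norm of a real matrix. -/
def frobSq {m n : Type*} [Fintype m] [Fintype n] (A : Matrix m n ℝ) : ℝ :=
  ∑ i, ∑ j, A i j ^ 2

/-- `x` is a (not necessarily unique) minimizer of `f` over the set `S`. -/
def IsArgmin {α : Type*} (f : α → ℝ) (S : Set α) (x : α) : Prop :=
  x ∈ S ∧ ∀ z ∈ S, f x ≤ f z

/-- The gradient of a function of an `r × T` matrix for the Frobenius inner product: the matrix of
its partial derivatives. -/
def matGrad {r T : ℕ} (f : Matrix (Fin r) (Fin T) ℝ → ℝ) (H : Matrix (Fin r) (Fin T) ℝ) :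
    Matrix (Fin r) (Fin T) ℝ :=
  Matrix.of fun s t => deriv (fun u : ℝ => f (H + u • Matrix.single s t (1 : ℝ))) 0

/-- The row-wise discrete Fourier transform
`Ĥ[s,k] = (1/T) ∑_f H[s,f] exp(-2π i f k / T)`. -/
def rowDFT {r T : ℕ} (H : Matrix (Fin r) (Fin T) ℝ) : Matrix (Fin r) (Fin T) ℂ :=
  Matrix.of fun s k => (1 / (T : ℂ)) * ∑ f : Fin T, (H s f : ℂ) *
    Complex.exp (-(2 * (Real.pi : ℂ) * Complex.I * ((f : ℕ) : ℂ) * ((k : ℕ) : ℂ)) / (T : ℂ))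

/-- The entrywise nonnegative matrices. -/
def nonnegSet (r T : ℕ) : Set (Matrix (Fin r) (Fin T) ℝ) :=
  {H | ∀ s t, 0 ≤ H s t}

/-- The real matrices whose rows only use the frequencies in `K`. -/
def freqSet (r : ℕ) {T : ℕ} (K : Set (Fin T)) : Set (Matrix (Fin r) (Fin T) ℝ) :=
  {H | ∀ s k, k ∉ K → rowDFT H s k = 0}

/-- The hard constraint: nonnegative, and supported on the frequencies in `K`. -/
def hardSet (r : ℕ) {T : ℕ} (K : Set (Fin T)) : Set (Matrix (Fin r) (Fin T) ℝ) :=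
  nonnegSet r T ∩ freqSet r K

/-- The part of the objective that depends on `H`, with a ridge term of weight `lam ≥ 0`:
`‖X - W H‖² + ξ ‖Y - W' H‖² + lam ‖H‖²`. -/
def codingObj {d r T : ℕ} (X Y : Matrix (Fin d) (Fin T) ℝ) (ξ lam : ℝ)
    (W W' : Matrix (Fin d) (Fin r) ℝ) (H : Matrix (Fin r) (Fin T) ℝ) : ℝ :=
  frobSq (X - W * H) + ξ * frobSq (Y - W' * H) + lam * frobSq H

/-- The finite part of the objective,
`‖X - W H‖² + ξ ‖Y - W' H‖² + lam ‖H‖² + mu ‖W‖² + nu ‖W'‖²`.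
With `lam = mu = nu = 0` it is the objective of semi-nonnegative supervised factorization. -/
def objective {d r T : ℕ} (X Y : Matrix (Fin d) (Fin T) ℝ) (ξ lam mu nu : ℝ)
    (H : Matrix (Fin r) (Fin T) ℝ) (W W' : Matrix (Fin d) (Fin r) ℝ) : ℝ :=
  codingObj X Y ξ lam W W' H + mu * frobSq W + nu * frobSq W'

/-- Stationary point of the problem of minimizing `objective` subject to `H ∈ hardSet r K`:
the point is feasible, and the one-sided variation of the objective towards any other feasible
point is nonnegative. (The feasible set is convex and the objective is a polynomial.) -/
def IsStationary {d r T : ℕ} (X Y : Matrix (Fin d) (Fin T) ℝ) (ξ lam mu nu : ℝ) (K : Set (Fin T))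
    (H : Matrix (Fin r) (Fin T) ℝ) (W W' : Matrix (Fin d) (Fin r) ℝ) : Prop :=
  H ∈ hardSet r K ∧
    ∀ H₁ ∈ hardSet r K, ∀ W₁ W₁' : Matrix (Fin d) (Fin r) ℝ,
      0 ≤ deriv (fun u : ℝ => objective X Y ξ lam mu nu
        (H + u • (H₁ - H)) (W + u • (W₁ - W)) (W' + u • (W₁' - W'))) 0

/-- A run of three operator splitting for minimizing `f` over `nonnegSet ∩ freqSet K`, started at
`y 0`. The proximal operators of `γ` times the indicator functions (with `γ > 0`) are
the projections onto the two sets. The step size is `γ_j = 1 / √(∑_{τ<j} ‖∇f(H_τ)‖²)`; as long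
as this sum vanishes (in particular for `j = 0`), where the formula is meaningless, `γ_j` is an
arbitrary positive number. -/
structure IsTOSRun {r T : ℕ} (f : Matrix (Fin r) (Fin T) ℝ → ℝ) (K : Set (Fin T))
    (y H G : ℕ → Matrix (Fin r) (Fin T) ℝ) (γ : ℕ → ℝ) : Prop where
  step_pos : ∀ j, 0 < γ j
  step_eq : ∀ j, 0 < ∑ τ ∈ Finset.range j, frobSq (matGrad f (H τ)) →
    γ j = 1 / √(∑ τ ∈ Finset.range j, frobSq (matGrad f (H τ)))
  H_update : ∀ j, IsArgmin (fun Z => (1 / 2) * frobSq (y j - Z)) (nonnegSet r T) (H j)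
  G_update : ∀ j, IsArgmin
    (fun Z => (1 / 2) * frobSq ((2 : ℝ) • H j - y j - γ j • matGrad f (H j) - Z))
    (freqSet r K) (G j)
  y_update : ∀ j, y (j + 1) = y j - H j + G j

/-- The ergodic sequence `H̄_n = (1/(n+1)) ∑_{τ=0}^{n} H_τ`. -/
def ergodic {r T : ℕ} (H : ℕ → Matrix (Fin r) (Fin T) ℝ) (n : ℕ) : Matrix (Fin r) (Fin T) ℝ :=
  (1 / ((n : ℝ) + 1)) • ∑ τ ∈ Finset.range (n + 1), H τ

/-- `Hbar` is an output of three operator splitting iterated to convergence: the limit of the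
ergodic sequence of a run, from some starting point. -/
def IsTOSOutput {r T : ℕ} (f : Matrix (Fin r) (Fin T) ℝ → ℝ) (K : Set (Fin T))
    (Hbar : Matrix (Fin r) (Fin T) ℝ) : Prop :=
  ∃ (y H G : ℕ → Matrix (Fin r) (Fin T) ℝ) (γ : ℕ → ℝ),
    IsTOSRun f K y H G γ ∧ Tendsto (ergodic H) atTop (𝓝 Hbar)

/-- Three operator splitting solves the problem of minimizing `f` over `hardSet r K`: from every
starting point there is a run, and the ergodic sequence of every run from there converges to a
minimizer. -/
def TOSSolves {r T : ℕ} (f : Matrix (Fin r) (Fin T) ℝ → ℝ) (K : Set (Fin T)) : Prop :=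
  ∀ y₀ : Matrix (Fin r) (Fin T) ℝ,
    (∃ (y H G : ℕ → Matrix (Fin r) (Fin T) ℝ) (γ : ℕ → ℝ), y 0 = y₀ ∧ IsTOSRun f K y H G γ) ∧
    ∀ (y H G : ℕ → Matrix (Fin r) (Fin T) ℝ) (γ : ℕ → ℝ), y 0 = y₀ → IsTOSRun f K y H G γ →
      ∃ Hbar, IsArgmin f (hardSet r K) Hbar ∧ Tendsto (ergodic H) atTop (𝓝 Hbar)

/-- The iterates of factorization with hard frequency regularization: `H` is
updated by three operator splitting, then `W` and `W'` by exact (ridge) least squares. The initial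
`H 0`, `W 0`, `W' 0` are arbitrary. With `mu = nu = 0` and `ξ > 0` the last two updates
minimize `‖X - W H‖²` and `‖Y - W' H‖²`. -/
structure IsHardRun {d r T : ℕ} (X Y : Matrix (Fin d) (Fin T) ℝ) (ξ lam mu nu : ℝ)
    (K : Set (Fin T)) (H : ℕ → Matrix (Fin r) (Fin T) ℝ)
    (W W' : ℕ → Matrix (Fin d) (Fin r) ℝ) : Prop where
  H_update : ∀ j, IsTOSOutput (codingObj X Y ξ lam (W j) (W' j)) K (H (j + 1))
  W_update : ∀ j, IsArgmin (fun V => frobSq (X - V * H (j + 1)) + mu * frobSq V) Set.univ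
    (W (j + 1))
  W'_update : ∀ j, IsArgmin (fun V => ξ * frobSq (Y - V * H (j + 1)) + nu * frobSq V) Set.univ
    (W' (j + 1))

end

end SSNMF

/-! Every `H`-subproblem has the form: minimize `‖A x - b‖²` over the nonnegative vectors of a
subspace `L`. Neither injectivity of `A` nor coercivity is available. Compactness is replaced by
polyhedrality: linear images of the orthant are closed (`isClosed_image_orthant`). This gives
minimizers, and by separation a multiplier `v ≤ 0` at a minimizer `x`, with `v ⟂ x` and `v + ∇f(x) ⟂
L`.

For a step size `γ`, each point `x + q + γ v` with `q ≤ 0` and `q ⟂ L` is fixed by the splitting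
map, and `norm_sq_splitting_step_le` bounds how the distance to it decreases. Two cases arise,
according to the sum of the squared gradient norms.

If the sum is finite, steps may stay large, but the gradients at the iterates tend to zero. Averages
of the iterates and closedness of a cone yield a feasible point with zero gradient, so multipliers
can be taken zero, and the tail of the sum absorbs the error of the energy estimate.

If the sum is infinite, then `γ_j → 0`. Cocoercivity absorbs the error, and the drift of the fixed
points `x + q + γ_j v` is paid for by the monotone decrease of `γ_j`. Bounded iterates make the sum
grow at most linearly, so the steps are not summable, which forces the gradient towards its optimal
value along a subsequence.

In both cases an Opial-type argument (`tendsto_of_fejer`) gives convergence of the whole sequence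
`H_j`, hence of its averages.

The alternating scheme is then exact block minimization. The objective decreases to a limit, and the
minimality inequalities of both blocks pass to cluster points by continuity. The constraint involves
`H` alone, so blockwise minimality gives stationarity; compactness turns this into convergence of
the distance for bounded iterates. -/

namespace SSNMF

/-! ### The nonnegative orthant -/

section Orthant

variable {ι : Type*}

/-- The projection onto the nonnegative orthant. -/
noncomputable def posPart (y : EuclideanSpace ℝ ι) : EuclideanSpace ℝ ι :=
  WithLp.toLp 2 fun i => max (y i) 0

theorem posPart_nonneg (y : EuclideanSpace ℝ ι) (i : ι) : 0 ≤ posPart y i :=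
  le_max_right _ _

theorem sub_posPart_nonpos (y : EuclideanSpace ℝ ι) (i : ι) : (y - posPart y) i ≤ 0 := by
  simp [posPart]

theorem continuous_posPart : Continuous (posPart : EuclideanSpace ℝ ι → EuclideanSpace ℝ ι) := by
  unfold posPart
  fun_prop

variable [Fintype ι]

/-- The images under a linear map of the faces of the nonnegative orthant are closed. -/
theorem isClosed_image_face {F : Type*} [NormedAddCommGroup F] [NormedSpace ℝ F]
    (B : EuclideanSpace ℝ ι →ₗ[ℝ] F) (s : Finset ι) :
    IsClosed (B '' {x | (∀ i, 0 ≤ x i) ∧ ∀ i, i ∉ s → x i = 0}) := by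
  classical
  induction s using Finset.strongInduction with
  | H s ih =>
    let V : Submodule ℝ (EuclideanSpace ℝ ι) :=
      { carrier := {x | ∀ i, i ∉ s → x i = 0}
        add_mem' := fun {x y} hx hy i hi => by simp [hx i hi, hy i hi]
        zero_mem' := fun i _ => rfl
        smul_mem' := fun c x hx i hi => by simp [hx i hi] }
    -- If `B` is injective on the span of the face, it is a closed embedding there. Otherwise a
    -- kernel vector moves every point of the face to a smaller face without changing its image.
    by_cases hinj : Function.Injective (B.comp V.subtype)
    · have hemb := LinearMap.isClosedEmbedding_of_injective (LinearMap.ker_eq_bot.2 hinj)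
      have hcl : IsClosed {x : V | ∀ i, 0 ≤ (x : EuclideanSpace ℝ ι) i} := by
        simp only [Set.ofPred_forall]
        exact isClosed_iInter fun i => isClosed_le (by fun_prop) (by fun_prop)
      convert hemb.isClosedMap _ hcl using 1
      ext w
      constructor
      · rintro ⟨x, ⟨hx, hxs⟩, rfl⟩
        exact ⟨⟨x, hxs⟩, hx, rfl⟩
      · rintro ⟨⟨x, hxs⟩, hx, rfl⟩
        exact ⟨x, ⟨hx, hxs⟩, rfl⟩
    · obtain ⟨k, hkV, hBk, i₀, hi₀⟩ : ∃ k ∈ V, B k = 0 ∧ ∃ i, 0 < k i := by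
        rw [← LinearMap.ker_eq_bot, Submodule.eq_bot_iff] at hinj
        push Not at hinj
        obtain ⟨⟨k, hkV⟩, hk, hk0⟩ := hinj
        have hBk : B k = 0 := hk
        have hne : ∃ i, k i ≠ 0 := by
          by_contra! h
          exact hk0 (Subtype.ext (PiLp.ext h))
        obtain ⟨i, hi⟩ := hne
        rcases lt_or_gt_of_ne hi with h | h
        · exact ⟨-k, V.neg_mem hkV, by simp [hBk], i, by simpa using h⟩
        · exact ⟨k, hkV, hBk, i, h⟩
      have hunion : B '' {x | (∀ i, 0 ≤ x i) ∧ ∀ i, i ∉ s → x i = 0} =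
          ⋃ j ∈ s, B '' {x | (∀ i, 0 ≤ x i) ∧ ∀ i, i ∉ s.erase j → x i = 0} := by
        ext w
        simp only [Set.mem_iUnion]
        constructor
        · rintro ⟨x, ⟨hx, hxs⟩, rfl⟩
          have hne : (s.filter fun i => 0 < k i).Nonempty := by
            refine ⟨i₀, Finset.mem_filter.2 ⟨?_, hi₀⟩⟩
            by_contra h
            exact hi₀.ne' (hkV _ h)
          -- Ratio test: `x - t k` stays nonnegative as `t` grows until the first coordinate with `k
          -- i > 0` vanishes.
          obtain ⟨j, hj, hmin⟩ := Finset.exists_min_image _ (fun i => x i / k i) hne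
          obtain ⟨hjs, hkj⟩ := Finset.mem_filter.1 hj
          refine ⟨j, hjs, x - (x j / k j) • k, ⟨fun i => ?_, fun i hi => ?_⟩, by simp [hBk]⟩
          · have ht : 0 ≤ x j / k j := div_nonneg (hx j) hkj.le
            simp only [PiLp.sub_apply, PiLp.smul_apply, smul_eq_mul, sub_nonneg]
            rcases le_or_gt (k i) 0 with h | h
            · exact (mul_nonpos_of_nonneg_of_nonpos ht h).trans (hx i)
            · have his : i ∈ s := by
                by_contra h'
                exact h.ne' (hkV _ h')
              exact (le_div_iff₀ h).1 (hmin i (Finset.mem_filter.2 ⟨his, h⟩))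
          · by_cases hij : i = j
            · subst hij
              simp [div_mul_cancel₀ _ hkj.ne']
            · have his : i ∉ s := fun h => hi (Finset.mem_erase.2 ⟨hij, h⟩)
              simp [hxs i his, hkV i his]
        · rintro ⟨j, hj, x, ⟨hx, hxs⟩, rfl⟩
          exact ⟨x, ⟨hx, fun i hi => hxs i fun h => hi (Finset.mem_of_mem_erase h)⟩, rfl⟩
      rw [hunion]
      exact s.finite_toSet.isClosed_biUnion fun j hj => ih _ (Finset.erase_ssubset hj)

/-- Finitely generated cones are closed. -/
theorem isClosed_image_orthant {F : Type*} [NormedAddCommGroup F] [NormedSpace ℝ F]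
    (B : EuclideanSpace ℝ ι →ₗ[ℝ] F) : IsClosed (B '' {x | ∀ i, 0 ≤ x i}) := by
  simpa using isClosed_image_face B Finset.univ

theorem inner_nonneg_of_nonneg {x y : EuclideanSpace ℝ ι} (hx : ∀ i, 0 ≤ x i)
    (hy : ∀ i, 0 ≤ y i) : 0 ≤ inner ℝ x y := by
  simp only [PiLp.inner_apply, RCLike.inner_apply, conj_trivial]
  exact Finset.sum_nonneg fun i _ => mul_nonneg (hy i) (hx i)

theorem inner_nonpos_of_nonpos {u x : EuclideanSpace ℝ ι} (hu : ∀ i, u i ≤ 0)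
    (hx : ∀ i, 0 ≤ x i) : inner ℝ u x ≤ 0 := by
  have := inner_nonneg_of_nonneg (x := -u) (fun i => by simpa using hu i) hx
  rw [inner_neg_left] at this
  linarith

theorem inner_sub_posPart (y : EuclideanSpace ℝ ι) : inner ℝ (y - posPart y) (posPart y) = 0 := by
  simp only [PiLp.inner_apply, RCLike.inner_apply, conj_trivial]
  refine Finset.sum_eq_zero fun i _ => ?_
  rcases le_total (y i) 0 with h | h <;> simp [posPart, h]

theorem norm_sq_posPart_add (y : EuclideanSpace ℝ ι) :
    ‖y‖ ^ 2 = ‖posPart y‖ ^ 2 + ‖y - posPart y‖ ^ 2 := by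
  have h := inner_sub_posPart y
  have := norm_add_sq_real (y - posPart y) (posPart y)
  rw [sub_add_cancel, h] at this
  linarith

end Orthant

/-! ### Least squares over a subspace of the nonnegative orthant -/

section LeastSquares

variable {ι κ : Type*} [Fintype ι] [Fintype κ]
  (A : EuclideanSpace ℝ ι →L[ℝ] EuclideanSpace ℝ κ) (b : EuclideanSpace ℝ κ)
  (L : Submodule ℝ (EuclideanSpace ℝ ι))

/-- The gradient of `x ↦ ‖A x - b‖²`. -/
noncomputable def lsqGrad (x : EuclideanSpace ℝ ι) : EuclideanSpace ℝ ι :=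
  (2 : ℝ) • ContinuousLinearMap.adjoint A (A x - b)

/-- `x` minimizes `‖A x - b‖²` over the nonnegative vectors of `L`. -/
def IsLsqMin (x : EuclideanSpace ℝ ι) : Prop :=
  ((∀ i, 0 ≤ x i) ∧ x ∈ L) ∧
    ∀ z : EuclideanSpace ℝ ι, (∀ i, 0 ≤ z i) → z ∈ L → ‖A x - b‖ ^ 2 ≤ ‖A z - b‖ ^ 2

theorem continuous_lsqGrad : Continuous (lsqGrad A b) := by
  unfold lsqGrad
  fun_prop

theorem lsqGrad_sub (x y : EuclideanSpace ℝ ι) :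
    lsqGrad A b x - lsqGrad A b y = (2 : ℝ) • ContinuousLinearMap.adjoint A (A (x - y)) := by
  simp [lsqGrad, ← smul_sub]

theorem inner_lsqGrad (x z : EuclideanSpace ℝ ι) :
    inner ℝ (lsqGrad A b x) z = 2 * inner ℝ (A x - b) (A z) := by
  rw [lsqGrad, real_inner_smul_left, ContinuousLinearMap.adjoint_inner_left]

theorem inner_lsqGrad_sub (x y : EuclideanSpace ℝ ι) :
    inner ℝ (x - y) (lsqGrad A b x - lsqGrad A b y) = 2 * ‖A (x - y)‖ ^ 2 := by
  rw [lsqGrad_sub, real_inner_smul_right, ContinuousLinearMap.adjoint_inner_right,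
    real_inner_self_eq_norm_sq]

/-- Cocoercivity of the gradient. -/
theorem norm_lsqGrad_sub_sq_le (x y : EuclideanSpace ℝ ι) :
    ‖lsqGrad A b x - lsqGrad A b y‖ ^ 2 ≤
      (2 * ‖A‖ ^ 2 + 1) * inner ℝ (x - y) (lsqGrad A b x - lsqGrad A b y) := by
  rw [inner_lsqGrad_sub, lsqGrad_sub, norm_smul, Real.norm_ofNat]
  have h := (ContinuousLinearMap.adjoint A).le_opNorm (A (x - y))
  rw [LinearIsometryEquiv.norm_map] at h
  have h2 := mul_self_le_mul_self (norm_nonneg _) h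
  nlinarith [sq_nonneg ‖A (x - y)‖]

theorem lsq_add_smul (x z : EuclideanSpace ℝ ι) (t : ℝ) :
    ‖A (x + t • z) - b‖ ^ 2 =
      ‖A x - b‖ ^ 2 + t * inner ℝ (lsqGrad A b x) z + t ^ 2 * ‖A z‖ ^ 2 := by
  have : A (x + t • z) - b = (A x - b) + t • A z := by
    rw [map_add, map_smul]; abel
  rw [this, norm_add_sq_real, real_inner_smul_right, norm_smul, mul_pow, inner_lsqGrad,
    Real.norm_eq_abs, sq_abs]
  ring

/-- Minimizing sequences may be unbounded, so the nearest point to `b` is sought in the image.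
Vanishing of the second component of `B` encodes `x ∈ L`; thus the image of the feasible set is a
slice of a closed cone. -/
theorem exists_isLsqMin : ∃ x, IsLsqMin A b L x := by
  let B : EuclideanSpace ℝ ι →ₗ[ℝ] EuclideanSpace ℝ κ × EuclideanSpace ℝ ι :=
    (A : EuclideanSpace ℝ ι →ₗ[ℝ] EuclideanSpace ℝ κ).prod
      (LinearMap.id - (L.starProjection : EuclideanSpace ℝ ι →ₗ[ℝ] EuclideanSpace ℝ ι))
  have hcl := (isClosed_image_orthant B).preimage
    (show Continuous fun w : EuclideanSpace ℝ κ => (w, (0 : EuclideanSpace ℝ ι)) by fun_prop)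
  have hmem : ∀ w, w ∈ (fun w : EuclideanSpace ℝ κ => (w, (0 : EuclideanSpace ℝ ι))) ⁻¹'
      (B '' {x | ∀ i, 0 ≤ x i}) ↔ ∃ x : EuclideanSpace ℝ ι, (∀ i, 0 ≤ x i) ∧ x ∈ L ∧ A x = w := by
    intro w
    constructor
    · rintro ⟨x, hx, h⟩
      have h1 : A x = w := congrArg Prod.fst h
      have h2 : x - L.starProjection x = 0 := congrArg Prod.snd h
      exact ⟨x, hx, Submodule.starProjection_eq_self_iff.1 (sub_eq_zero.1 h2).symm, h1⟩
    · rintro ⟨x, hx, hxL, h⟩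
      refine ⟨x, hx, Prod.ext h ?_⟩
      change x - L.starProjection x = 0
      rw [Submodule.starProjection_eq_self_iff.2 hxL, sub_self]
  obtain ⟨w, hw, hdist⟩ := hcl.exists_infDist_eq_dist
    ⟨0, (hmem 0).2 ⟨0, fun i => le_rfl, L.zero_mem, map_zero A⟩⟩ b
  obtain ⟨x, hx, hxL, rfl⟩ := (hmem w).1 hw
  refine ⟨x, ⟨hx, hxL⟩, fun z hz hzL => ?_⟩
  have := Metric.infDist_le_dist_of_mem (x := b) ((hmem (A z)).2 ⟨z, hz, hzL, rfl⟩)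
  rw [hdist, dist_comm, dist_eq_norm, dist_comm, dist_eq_norm] at this
  gcongr

variable {A b L}

theorem IsLsqMin.inner_nonneg {x : EuclideanSpace ℝ ι} (h : IsLsqMin A b L x)
    {z : EuclideanSpace ℝ ι} (hz : ∀ i, 0 ≤ z i) (hzL : z ∈ L) :
    0 ≤ inner ℝ (lsqGrad A b x) z := by
  by_contra! hneg
  set c := inner ℝ (lsqGrad A b x) z
  set n := ‖A z‖ ^ 2 with hn
  have hn0 : 0 ≤ n := sq_nonneg _
  -- With this step length `t`, the change `t c + t² n` of the objective equals `-t²`.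
  have ht : 0 < -c / (n + 1) := div_pos (by linarith) (by linarith)
  have := h.2 (x + (-c / (n + 1)) • z)
    (fun i => add_nonneg (h.1.1 i) (mul_nonneg ht.le (hz i))) (L.add_mem h.1.2 (L.smul_mem _ hzL))
  rw [lsq_add_smul] at this
  have h3 : (-c / (n + 1)) * (n + 1) = -c := div_mul_cancel₀ _ (by linarith)
  nlinarith [mul_pos ht ht]

theorem IsLsqMin.inner_self {x : EuclideanSpace ℝ ι} (h : IsLsqMin A b L x) :
    inner ℝ (lsqGrad A b x) x = 0 := by
  refine le_antisymm ?_ (h.inner_nonneg h.1.1 h.1.2)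
  by_contra! hpos
  set c := inner ℝ (lsqGrad A b x) x
  set n := ‖A x‖ ^ 2 with hn
  have hn0 : 0 ≤ n := sq_nonneg _
  -- The term `c` in the denominator gives `t ≤ 1`, so `(1 - t) x` stays feasible; the objective
  -- changes by `-t² (c + 1)`.
  set t := c / (n + c + 1) with ht_def
  have ht : 0 < t := div_pos hpos (by linarith)
  have h3 : t * (n + c + 1) = c := div_mul_cancel₀ _ (by linarith)
  have ht1 : t ≤ 1 := (div_le_one (by linarith)).2 (by linarith)
  have := h.2 (x + (-t) • x)
    (fun i => by
      have := mul_nonneg (sub_nonneg.2 ht1) (h.1.1 i)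
      simp only [PiLp.add_apply, PiLp.smul_apply, smul_eq_mul]
      linarith) (L.add_mem h.1.2 (L.smul_mem _ h.1.2))
  rw [lsq_add_smul] at this
  nlinarith [mul_pos ht ht, mul_pos (mul_pos ht ht) hpos]

/-- Existence of multipliers for the sign constraint. -/
theorem IsLsqMin.exists_multiplier {x : EuclideanSpace ℝ ι} (h : IsLsqMin A b L x) :
    ∃ v : EuclideanSpace ℝ ι, (∀ i, v i ≤ 0) ∧ inner ℝ v x = 0 ∧
      L.starProjection (v + lsqGrad A b x) = 0 := by
  classical
  set g := lsqGrad A b x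
  let P : EuclideanSpace ℝ ι →ₗ[ℝ] EuclideanSpace ℝ ι := L.starProjection
  let C : ProperCone ℝ (EuclideanSpace ℝ ι) :=
    { carrier := P '' {x | ∀ i, 0 ≤ x i}
      add_mem' := by
        rintro _ _ ⟨y, hy, rfl⟩ ⟨z, hz, rfl⟩
        exact ⟨y + z, fun i => add_nonneg (hy i) (hz i), map_add _ _ _⟩
      zero_mem' := ⟨0, fun i => le_rfl, map_zero _⟩
      smul_mem' := by
        rintro ⟨c, hc⟩ _ ⟨y, hy, rfl⟩
        exact ⟨c • y, fun i => mul_nonneg hc (hy i), map_smul _ _ _⟩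
      isClosed' := isClosed_image_orthant P }
  have hmemC : ∀ w, w ∈ C ↔ w ∈ P '' {x | ∀ i, 0 ≤ x i} := fun _ => Iff.rfl
  -- A vector `w` separating the projected gradient from the cone would give the feasible direction
  -- `L.starProjection w` (nonnegative, by testing on coordinate vectors) along which the objective
  -- decreases.
  have key : L.starProjection g ∈ C := by
    by_contra hg
    obtain ⟨w, hw, hwg⟩ := C.hyperplane_separation' hg
    have hsymm : ∀ y z, inner ℝ (L.starProjection y) z = inner ℝ y (L.starProjection z) :=
      fun y z => L.inner_starProjection_left_eq_right y z
    have hpos : ∀ i, 0 ≤ L.starProjection w i := by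
      intro i
      have := hw (P (EuclideanSpace.single i 1)) ((hmemC _).2 ⟨_, fun j => by
        by_cases hij : j = i <;> simp [hij], rfl⟩)
      change 0 ≤ inner ℝ (L.starProjection (EuclideanSpace.single i 1)) w at this
      rw [hsymm, EuclideanSpace.inner_single_left] at this
      simpa using this
    have := h.inner_nonneg hpos (L.starProjection_apply_mem w)
    rw [← hsymm] at this
    linarith
  obtain ⟨n, hn, hPn⟩ := (hmemC _).1 key
  have hPn : L.starProjection n = L.starProjection g := hPn
  refine ⟨-n, fun i => by simpa using hn i, ?_, by rw [map_add, map_neg, hPn, neg_add_cancel]⟩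
  rw [← Submodule.starProjection_eq_self_iff.2 h.1.2, ← L.inner_starProjection_left_eq_right,
    map_neg, hPn, inner_neg_left, L.inner_starProjection_left_eq_right,
    Submodule.starProjection_eq_self_iff.2 h.1.2, h.inner_self, neg_zero]

/-- The gradient determines `A x`, hence the value of the objective. Optimality of a limit point is
therefore recognized from its feasibility and its gradient alone. -/
theorem IsLsqMin.of_lsqGrad_eq {x y : EuclideanSpace ℝ ι} (h : IsLsqMin A b L x)
    (hy : ∀ i, 0 ≤ y i) (hyL : y ∈ L) (hg : lsqGrad A b y = lsqGrad A b x) :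
    IsLsqMin A b L y := by
  have h0 := inner_lsqGrad_sub A b y x
  rw [hg, sub_self, inner_zero_right] at h0
  have h1 : A y = A x := by
    rw [← sub_eq_zero, ← map_sub, ← norm_eq_zero]
    nlinarith [norm_nonneg (A (y - x))]
  refine ⟨⟨hy, hyL⟩, fun z hz hzL => ?_⟩
  rw [h1]
  exact h.2 z hz hzL

theorem isLsqMin_of_lsqGrad_eq_zero {x : EuclideanSpace ℝ ι} (hx : ∀ i, 0 ≤ x i) (hxL : x ∈ L)
    (hg : lsqGrad A b x = 0) : IsLsqMin A b L x := by
  refine ⟨⟨hx, hxL⟩, fun z _ _ => ?_⟩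
  have := lsq_add_smul A b x (z - x) 1
  rw [one_smul, add_sub_cancel, hg, inner_zero_left] at this
  nlinarith [sq_nonneg ‖A (z - x)‖]

theorem IsLsqMin.lsqGrad_eq_zero {x y : EuclideanSpace ℝ ι} (h : IsLsqMin A b L y)
    (hx : ∀ i, 0 ≤ x i) (hxL : x ∈ L) (hg : lsqGrad A b x = 0) : lsqGrad A b y = 0 := by
  have h1 := lsq_add_smul A b x (y - x) 1
  rw [one_smul, add_sub_cancel, hg, inner_zero_left] at h1
  have h2 := h.2 x hx hxL
  have h3 : A (y - x) = 0 := by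
    rw [← norm_eq_zero]
    nlinarith [norm_nonneg (A (y - x))]
  have := lsqGrad_sub A b y x
  rwa [h3, map_zero, smul_zero, hg, sub_zero] at this

end LeastSquares

/-! ### Three operator splitting for least squares -/

section Splitting

variable {ι κ : Type*} [Fintype ι] [Fintype κ]
  {A : EuclideanSpace ℝ ι →L[ℝ] EuclideanSpace ℝ κ} {b : EuclideanSpace ℝ κ}
  {L : Submodule ℝ (EuclideanSpace ℝ ι)}

theorem inner_starProjection_sub_starProjection {E : Type*} [NormedAddCommGroup E]
    [InnerProductSpace ℝ E] (L : Submodule ℝ E) [L.HasOrthogonalProjection] (y z : E) :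
    inner ℝ (L.starProjection y) (z - L.starProjection z) = 0 :=
  Submodule.inner_right_of_mem_orthogonal (L.starProjection_apply_mem y)
    (L.sub_starProjection_mem_orthogonal z)

/-- The energy estimate in abstract form: `a`, `c` and `e` stand for the errors in the primal
iterate, in the normal vector and in the gradient. Everything splits orthogonally along `L`. -/
theorem norm_sq_splitting_le {E : Type*} [NormedAddCommGroup E]
    [InnerProductSpace ℝ E] (L : Submodule ℝ E) [L.HasOrthogonalProjection] (a c e : E) (γ : ℝ)
    (hac : 0 ≤ inner ℝ a c) :
    ‖L.starProjection (a - γ • e) + (c - L.starProjection c)‖ ^ 2 +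
      (1 / 2 * ‖a - L.starProjection a‖ ^ 2 + ‖L.starProjection c‖ ^ 2 + 2 * γ * inner ℝ a e -
        3 * γ ^ 2 * ‖e‖ ^ 2) ≤ ‖a + c‖ ^ 2 := by
  have split : ∀ y : E, ‖y‖ ^ 2 = ‖L.starProjection y‖ ^ 2 + ‖y - L.starProjection y‖ ^ 2 := by
    intro y
    have := norm_add_sq_real (L.starProjection y) (y - L.starProjection y)
    rwa [add_sub_cancel, inner_starProjection_sub_starProjection, mul_zero, add_zero] at this
  have hinner : inner ℝ a e = inner ℝ (L.starProjection a) (L.starProjection e) +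
      inner ℝ (a - L.starProjection a) (e - L.starProjection e) := by
    conv_lhs => rw [← add_sub_cancel (L.starProjection a) a, ← add_sub_cancel (L.starProjection e) e]
    rw [inner_add_left, inner_add_right, inner_add_right, inner_starProjection_sub_starProjection,
      real_inner_comm (L.starProjection e) (a - L.starProjection a),
      inner_starProjection_sub_starProjection]
    ring
  have h1 : ‖L.starProjection (a - γ • e) + (c - L.starProjection c)‖ ^ 2 =
      ‖L.starProjection a‖ ^ 2 - 2 * γ * inner ℝ (L.starProjection a) (L.starProjection e) +
        γ ^ 2 * ‖L.starProjection e‖ ^ 2 + ‖c - L.starProjection c‖ ^ 2 := by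
    rw [norm_add_sq_real, inner_starProjection_sub_starProjection, map_sub, map_smul,
      norm_sub_sq_real, real_inner_smul_right, norm_smul, mul_pow, Real.norm_eq_abs, sq_abs]
    ring
  -- Young's inequality on the component orthogonal to `L`: half of `‖a - L.starProjection a‖ ^ 2`
  -- is spent on the cross term with `e`, which leaves the factor `1 / 2` in the statement.
  have h2 : 0 ≤ ‖(a - L.starProjection a) - (2 * γ) • (e - L.starProjection e)‖ ^ 2 := sq_nonneg _
  rw [norm_sub_sq_real, real_inner_smul_right, norm_smul, mul_pow, Real.norm_eq_abs, sq_abs] at h2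
  rw [h1, norm_add_sq_real, split a, split c, split e, hinner]
  nlinarith [mul_nonneg (sq_nonneg γ) (sq_nonneg ‖L.starProjection e‖)]

/-- The distance to the point `xs + U`, a fixed point of the splitting operator with step `γ`,
decreases in a splitting step. -/
theorem norm_sq_splitting_step_le (y : EuclideanSpace ℝ ι) {xs U : EuclideanSpace ℝ ι} {γ : ℝ}
    (hxs : ∀ i, 0 ≤ xs i) (hxsL : xs ∈ L) (hU : ∀ i, U i ≤ 0) (hUxs : inner ℝ U xs = 0)
    (hfix : L.starProjection (U + γ • lsqGrad A b xs) = 0) :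
    ‖y - posPart y + L.starProjection ((2 : ℝ) • posPart y - y - γ • lsqGrad A b (posPart y)) -
        (xs + U)‖ ^ 2 +
      (1 / 2 * ‖posPart y - L.starProjection (posPart y)‖ ^ 2 +
        ‖L.starProjection (y - posPart y - U)‖ ^ 2 +
        2 * γ * inner ℝ (posPart y - xs) (lsqGrad A b (posPart y) - lsqGrad A b xs) -
        3 * γ ^ 2 * ‖lsqGrad A b (posPart y) - lsqGrad A b xs‖ ^ 2) ≤ ‖y - (xs + U)‖ ^ 2 := by
  have hPxs := Submodule.starProjection_eq_self_iff.2 hxsL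
  -- Monotonicity of the normal cone of the orthant: `y - posPart y` is normal at `posPart y`, and
  -- `U` is normal at `xs`.
  have hac : 0 ≤ inner ℝ (posPart y - xs) (y - posPart y - U) := by
    have h1 := inner_nonpos_of_nonpos hU (posPart_nonneg y)
    have h2 := inner_nonpos_of_nonpos (sub_posPart_nonpos y) hxs
    have h3 := inner_sub_posPart y
    rw [real_inner_comm, inner_sub_left, inner_sub_right, inner_sub_right]
    linarith
  have key := norm_sq_splitting_le L _ _ (lsqGrad A b (posPart y) - lsqGrad A b xs) γ hac
  have e1 : posPart y - xs + (y - posPart y - U) = y - (xs + U) := by abel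
  have e2 : posPart y - xs - L.starProjection (posPart y - xs) =
      posPart y - L.starProjection (posPart y) := by
    rw [map_sub, hPxs]; abel
  have e3 : L.starProjection (posPart y - xs - γ • (lsqGrad A b (posPart y) - lsqGrad A b xs)) +
      (y - posPart y - U - L.starProjection (y - posPart y - U)) =
      y - posPart y + L.starProjection ((2 : ℝ) • posPart y - y - γ • lsqGrad A b (posPart y)) -
        (xs + U) := by
    have h := hfix
    rw [map_add, map_smul] at h
    simp only [map_sub, map_smul, smul_sub, hPxs, two_smul, map_add]
    rw [← sub_eq_zero, ← h]
    abel
  rwa [e1, e2, e3] at key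

/-- Without the gradient term the splitting map does not increase the norm, and the projection of
`p` adds at most `‖p‖`. This controls the growth of the iterates before any minimizer is at hand. -/
theorem norm_splitting_le (y p : EuclideanSpace ℝ ι) :
    ‖y - posPart y + L.starProjection ((2 : ℝ) • posPart y - y - p)‖ ≤ ‖y‖ + ‖p‖ := by
  have h := norm_sq_splitting_le L (posPart y) (y - posPart y) 0 0
    (by rw [real_inner_comm, inner_sub_posPart])
  have e : y - posPart y + L.starProjection ((2 : ℝ) • posPart y - y - p) =
      (L.starProjection (posPart y - (0 : ℝ) • (0 : EuclideanSpace ℝ ι)) +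
        (y - posPart y - L.starProjection (y - posPart y))) - L.starProjection p := by
    simp only [map_sub, two_smul, map_add, smul_zero, map_zero]
    abel
  rw [e]
  refine (norm_sub_le _ _).trans (add_le_add ?_ (L.norm_starProjection_apply_le p))
  rw [add_sub_cancel] at h
  refine le_of_sq_le_sq ?_ (norm_nonneg _)
  simp only [norm_zero, inner_zero_right] at h
  nlinarith [sq_nonneg ‖posPart y - L.starProjection (posPart y)‖,
    sq_nonneg ‖L.starProjection (y - posPart y)‖]

/-- A run of three operator splitting with adaptive step size for `‖A x - b‖²` over the
nonnegative vectors of `L`. -/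
structure IsLsqRun (A : EuclideanSpace ℝ ι →L[ℝ] EuclideanSpace ℝ κ) (b : EuclideanSpace ℝ κ)
    (L : Submodule ℝ (EuclideanSpace ℝ ι)) (y : ℕ → EuclideanSpace ℝ ι) (γ : ℕ → ℝ) : Prop where
  step_pos : ∀ j, 0 < γ j
  step_eq : ∀ j, 0 < ∑ τ ∈ Finset.range j, ‖lsqGrad A b (posPart (y τ))‖ ^ 2 →
    γ j = 1 / √(∑ τ ∈ Finset.range j, ‖lsqGrad A b (posPart (y τ))‖ ^ 2)
  update : ∀ j, y (j + 1) = y j - posPart (y j) +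
    L.starProjection ((2 : ℝ) • posPart (y j) - y j - γ j • lsqGrad A b (posPart (y j)))

/-- Convergence to a minimizer, from quasi-Fejér monotonicity and one good subsequence. -/
theorem tendsto_of_fejer {y : ℕ → EuclideanSpace ℝ ι} {xs : EuclideanSpace ℝ ι}
    (hxs : IsLsqMin A b L xs)
    (hfejer : ∀ x q : EuclideanSpace ℝ ι, IsLsqMin A b L x → (∀ i, q i ≤ 0) →
      L.starProjection q = 0 → ∃ l, Tendsto (fun j => ‖y j - (x + q)‖) atTop (𝓝 l))
    {φ : ℕ → ℕ} (hφ : StrictMono φ)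
    (hx : Tendsto (fun k => posPart (y (φ k)) - L.starProjection (posPart (y (φ k)))) atTop (𝓝 0))
    (hu : Tendsto (fun k => L.starProjection (y (φ k) - posPart (y (φ k)))) atTop (𝓝 0))
    (hg : Tendsto (fun k => lsqGrad A b (posPart (y (φ k)))) atTop (𝓝 (lsqGrad A b xs))) :
    ∃ x, IsLsqMin A b L x ∧ Tendsto (fun j => posPart (y j)) atTop (𝓝 x) := by
  obtain ⟨l, hl⟩ := hfejer xs 0 hxs (fun i => le_rfl) (map_zero _)
  obtain ⟨R, hR⟩ := hl.bddAbove_range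
  have hbdd : ∀ k, y (φ k) ∈ Metric.closedBall (xs + 0) R := fun k => by
    rw [Metric.mem_closedBall, dist_eq_norm]
    exact hR ⟨φ k, rfl⟩
  obtain ⟨y₁, -, ψ, hψ, hlim⟩ := (isCompact_closedBall (xs + 0) R).tendsto_subseq hbdd
  have hpos := (continuous_posPart.tendsto y₁).comp hlim
  have h1 : posPart y₁ - L.starProjection (posPart y₁) = 0 := by
    refine tendsto_nhds_unique ?_ (hx.comp hψ.tendsto_atTop)
    exact hpos.sub ((L.starProjection.continuous.tendsto _).comp hpos)
  have h2 : L.starProjection (y₁ - posPart y₁) = 0 := by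
    refine tendsto_nhds_unique ?_ (hu.comp hψ.tendsto_atTop)
    exact (L.starProjection.continuous.tendsto _).comp (hlim.sub hpos)
  have h3 : lsqGrad A b (posPart y₁) = lsqGrad A b xs :=
    tendsto_nhds_unique (((continuous_lsqGrad A b).tendsto _).comp hpos)
      (hg.comp hψ.tendsto_atTop)
  have hmin : IsLsqMin A b L (posPart y₁) := hxs.of_lsqGrad_eq (posPart_nonneg y₁)
    (Submodule.starProjection_eq_self_iff.1 (sub_eq_zero.1 h1).symm) h3
  refine ⟨posPart y₁, hmin, (continuous_posPart.tendsto y₁).comp ?_⟩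
  -- The cluster point `y₁` is itself of the form `x + q`, with `q` its negative part. So the
  -- distance to `y₁` converges, and it tends to zero along a subsequence.
  obtain ⟨l', hl'⟩ := hfejer _ _ hmin (sub_posPart_nonpos y₁) h2
  rw [add_sub_cancel] at hl'
  have hsub := hl'.comp ((hφ.comp hψ).tendsto_atTop)
  have hzero : l' = 0 := by
    refine tendsto_nhds_unique hsub ?_
    exact tendsto_iff_norm_sub_tendsto_zero.1 hlim
  rw [hzero] at hl'
  exact tendsto_iff_norm_sub_tendsto_zero.2 hl'

/-- An eventually decreasing energy converges, and its decrements are summable. -/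
theorem tendsto_and_summable_of_energy {E D : ℕ → ℝ} {N : ℕ} (hE : ∀ j, 0 ≤ E j)
    (hD : ∀ j, N ≤ j → 0 ≤ D j) (h : ∀ j, N ≤ j → E (j + 1) + D j ≤ E j) :
    (∃ l, Tendsto E atTop (𝓝 l)) ∧ Summable D := by
  constructor
  · have hanti : Antitone fun j => E (j + N) := antitone_nat_of_succ_le fun j => by
      have h1 := h (j + N) (by omega)
      have h2 := hD (j + N) (by omega)
      rw [show j + 1 + N = j + N + 1 by omega]
      linarith
    refine ⟨_, (tendsto_add_atTop_iff_nat N).1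
      (tendsto_atTop_ciInf hanti ⟨0, ?_⟩)⟩
    rintro _ ⟨j, rfl⟩
    exact hE _
  · refine (summable_nat_add_iff N).1 ?_
    refine summable_of_sum_range_le (c := E N) (fun j => hD _ (by omega)) fun n => ?_
    have : ∑ i ∈ Finset.range n, D (i + N) ≤ E N - E (n + N) := by
      induction n with
      | zero => simp
      | succ n ih =>
        rw [Finset.sum_range_succ, show n + 1 + N = n + N + 1 by omega]
        linarith [h (n + N) (by omega)]
    linarith [hE (n + N)]

/-! ### Convergence of the splitting iterates -/

namespace IsLsqRun

variable {y : ℕ → EuclideanSpace ℝ ι} {γ : ℕ → ℝ}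

/-- Once some gradient is nonzero, the step formula bounds all later steps. If all gradients vanish,
the steps are arbitrary and possibly unbounded, so the bound carries the gradient norm as a factor.
-/
theorem exists_step_bound (hrun : IsLsqRun A b L y γ) :
    ∃ Γ, 0 ≤ Γ ∧ ∀ j, γ j * ‖lsqGrad A b (posPart (y j))‖ ≤ Γ * ‖lsqGrad A b (posPart (y j))‖ := by
  by_cases h : ∀ j, lsqGrad A b (posPart (y j)) = 0
  · exact ⟨0, le_rfl, fun j => by simp [h j]⟩
  · push Not at h
    obtain ⟨J, hJ⟩ := h
    have hS : ∀ j, J + 1 ≤ j → ‖lsqGrad A b (posPart (y J))‖ ^ 2 ≤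
        ∑ τ ∈ Finset.range j, ‖lsqGrad A b (posPart (y τ))‖ ^ 2 := fun j hj =>
      Finset.single_le_sum (f := fun τ => ‖lsqGrad A b (posPart (y τ))‖ ^ 2)
        (fun _ _ => sq_nonneg _) (Finset.mem_range.2 hj)
    have hpos : 0 < ‖lsqGrad A b (posPart (y J))‖ ^ 2 := pow_pos (norm_pos_iff.2 hJ) 2
    have hb : ∀ᶠ j in atTop, γ j ≤ 1 / √(‖lsqGrad A b (posPart (y J))‖ ^ 2) := by
      filter_upwards [eventually_ge_atTop (J + 1)] with j hj
      rw [hrun.step_eq j (hpos.trans_le (hS j hj))]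
      exact one_div_le_one_div_of_le (Real.sqrt_pos.2 hpos) (Real.sqrt_le_sqrt (hS j hj))
    obtain ⟨Γ, hΓ⟩ := (isBoundedUnder_of_eventually_le hb).bddAbove_range
    have hΓ' : ∀ j, γ j ≤ Γ := fun j => hΓ ⟨j, rfl⟩
    exact ⟨Γ, (hrun.step_pos 0).le.trans (hΓ' 0), fun j =>
      mul_le_mul_of_nonneg_right (hΓ' j) (norm_nonneg _)⟩

/-- If the squared gradient norms are summable, the gradient vanishes at some feasible point. -/
theorem exists_lsqGrad_eq_zero (hrun : IsLsqRun A b L y γ)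
    (hsum : Summable fun j => ‖lsqGrad A b (posPart (y j))‖ ^ 2) :
    ∃ x : EuclideanSpace ℝ ι, (∀ i, 0 ≤ x i) ∧ x ∈ L ∧ lsqGrad A b x = 0 := by
  obtain ⟨Γ, hΓ0, hΓ⟩ := hrun.exists_step_bound
  have hg0 : Tendsto (fun j => lsqGrad A b (posPart (y j))) atTop (𝓝 0) := by
    rw [tendsto_zero_iff_norm_tendsto_zero]
    have := hsum.tendsto_atTop_zero.sqrt
    simpa [Real.sqrt_sq] using this
  set M : EuclideanSpace ℝ ι →L[ℝ] EuclideanSpace ℝ ι :=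
    (2 : ℝ) • (ContinuousLinearMap.adjoint A).comp A with hM
  set m : EuclideanSpace ℝ ι := (2 : ℝ) • ContinuousLinearMap.adjoint A b with hm
  have hgM : ∀ x, lsqGrad A b x = M x - m := fun x => by
    simp [lsqGrad, hM, hm, smul_sub]
  set Q : EuclideanSpace ℝ ι →L[ℝ] EuclideanSpace ℝ ι :=
    ContinuousLinearMap.id ℝ _ - L.starProjection with hQ
  have hQa : ∀ x, Q x = x - L.starProjection x := fun x => rfl
  -- The iterates are not known to be bounded here, so no limit point of these averages is
  -- extracted. Only their images under `M` and `Q` converge, and closedness of the image cone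
  -- supplies a preimage of the limit.
  set xbar : ℕ → EuclideanSpace ℝ ι := fun n =>
    (n : ℝ)⁻¹ • ∑ j ∈ Finset.range n, posPart (y j) with hxbar
  have hxbar0 : ∀ n i, 0 ≤ xbar n i := fun n i => by
    simp only [hxbar, PiLp.smul_apply, smul_eq_mul]
    refine mul_nonneg (by positivity) ?_
    have hs : (∑ j ∈ Finset.range n, posPart (y j)) i = ∑ j ∈ Finset.range n, posPart (y j) i := by
      simp
    rw [hs]
    exact Finset.sum_nonneg fun j _ => posPart_nonneg _ _
  -- Orthogonally to `L`, the update reads `y (j + 1) = y j - posPart (y j)`, so the sum telescopes.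
  have hQsum : ∀ n, ∑ j ∈ Finset.range n, Q (posPart (y j)) = -Q (y n - y 0) := by
    intro n
    induction n with
    | zero => simp
    | succ n ih =>
      rw [Finset.sum_range_succ, ih]
      have h1 : Q (y (n + 1)) = Q (y n) - Q (posPart (y n)) := by
        rw [hrun.update n, map_add, map_sub, hQa (L.starProjection _),
          Submodule.starProjection_eq_self_iff.2 (L.starProjection_apply_mem _), sub_self, add_zero]
      rw [map_sub, map_sub, h1]
      abel
  -- The gradients tend to zero, so this bound is `o(n)` by Cesàro, and dividing by `n` kills the
  -- component of `xbar n` orthogonal to `L`.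
  have hynorm : ∀ n, ‖y n‖ ≤ ‖y 0‖ + Γ * ∑ j ∈ Finset.range n, ‖lsqGrad A b (posPart (y j))‖ := by
    intro n
    induction n with
    | zero => simp
    | succ n ih =>
      rw [hrun.update n, Finset.sum_range_succ]
      refine (norm_splitting_le _ _).trans ?_
      rw [norm_smul, Real.norm_eq_abs, abs_of_pos (hrun.step_pos n)]
      linarith [hΓ n]
  have hQlim : Tendsto (fun n => Q (xbar n)) atTop (𝓝 0) := by
    have hbound : Tendsto (fun n : ℕ => (n : ℝ)⁻¹ * (2 * ‖y 0‖) + Γ * ((n : ℝ)⁻¹ *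
        ∑ j ∈ Finset.range n, ‖lsqGrad A b (posPart (y j))‖)) atTop (𝓝 0) := by
      have h1 := (tendsto_inv_atTop_nhds_zero_nat (𝕜 := ℝ)).mul_const (2 * ‖y 0‖)
      have h2 := (hg0.norm.cesaro).const_mul Γ
      simpa using h1.add h2
    refine squeeze_zero_norm (fun n => ?_) hbound
    have hQx : Q (xbar n) = (n : ℝ)⁻¹ • (-Q (y n - y 0)) := by
      rw [hxbar, map_smul, map_sum, hQsum]
    have hQle : ‖Q (y n - y 0)‖ ≤ ‖y n - y 0‖ := by
      rw [hQa, ← L.starProjection_orthogonal_val]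
      exact Lᗮ.norm_starProjection_apply_le _
    rw [hQx, norm_smul, norm_neg, Real.norm_eq_abs, abs_of_nonneg (by positivity)]
    calc (n : ℝ)⁻¹ * ‖Q (y n - y 0)‖ ≤ (n : ℝ)⁻¹ * (2 * ‖y 0‖ + Γ *
        ∑ j ∈ Finset.range n, ‖lsqGrad A b (posPart (y j))‖) := by
          refine mul_le_mul_of_nonneg_left ?_ (by positivity)
          linarith [norm_sub_le (y n) (y 0), hynorm n]
      _ = _ := by ring
  have hMlim : Tendsto (fun n => M (xbar n)) atTop (𝓝 m) := by
    have h1 : Tendsto (fun j => M (posPart (y j))) atTop (𝓝 m) := by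
      have := hg0.add_const m
      simpa [hgM] using this
    refine h1.cesaro_smul.congr fun n => ?_
    rw [hxbar, map_smul, map_sum]
  have hcl := isClosed_image_orthant
    ((M : EuclideanSpace ℝ ι →ₗ[ℝ] EuclideanSpace ℝ ι).prod (Q : _ →ₗ[ℝ] EuclideanSpace ℝ ι))
  obtain ⟨x, hx, hxe⟩ := hcl.mem_of_tendsto (hMlim.prodMk_nhds hQlim)
    (Eventually.of_forall fun n => ⟨xbar n, hxbar0 n, rfl⟩)
  have h1 : M x = m := congrArg Prod.fst hxe
  have h2 : Q x = 0 := congrArg Prod.snd hxe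
  refine ⟨x, hx, Submodule.starProjection_eq_self_iff.1 ?_, by rw [hgM, h1, sub_self]⟩
  rw [hQa, sub_eq_zero] at h2
  exact h2.symm

/-- The gradient vanishes at every minimizer, so `x + q` is fixed by the splitting map for every
step size, and no smallness of the steps is needed. -/
theorem tendsto_of_summable (hrun : IsLsqRun A b L y γ)
    (hsum : Summable fun j => ‖lsqGrad A b (posPart (y j))‖ ^ 2) :
    ∃ x, IsLsqMin A b L x ∧ Tendsto (fun j => posPart (y j)) atTop (𝓝 x) := by
  obtain ⟨xs, hxs0, hxsL, hgxs⟩ := hrun.exists_lsqGrad_eq_zero hsum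
  have hxs := isLsqMin_of_lsqGrad_eq_zero hxs0 hxsL hgxs
  obtain ⟨Γ, hΓ0, hΓ⟩ := hrun.exists_step_bound
  have hg0 : Tendsto (fun j => lsqGrad A b (posPart (y j))) atTop (𝓝 0) := by
    rw [tendsto_zero_iff_norm_tendsto_zero]
    have := hsum.tendsto_atTop_zero.sqrt
    simpa [Real.sqrt_sq] using this
  have energy : ∀ x q : EuclideanSpace ℝ ι, IsLsqMin A b L x → (∀ i, q i ≤ 0) →
      L.starProjection q = 0 → (∃ l, Tendsto (fun j => ‖y j - (x + q)‖) atTop (𝓝 l)) ∧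
        Summable fun j => 1 / 2 * ‖posPart (y j) - L.starProjection (posPart (y j))‖ ^ 2 +
          ‖L.starProjection (y j - posPart (y j))‖ ^ 2 := by
    intro x q hx hq hPq
    have hgx := hx.lsqGrad_eq_zero hxs0 hxsL hgxs
    have hqx : inner ℝ q x = 0 := by
      rw [← Submodule.starProjection_eq_self_iff.2 hx.1.2,
        ← L.inner_starProjection_left_eq_right, hPq, inner_zero_left]
    -- The tail of the series, weighted by `3 * Γ ^ 2`, drops at each step by at least the error `3
    -- γ² ‖∇f‖²` of the energy estimate.
    set T : ℕ → ℝ := fun j => ∑' k, ‖lsqGrad A b (posPart (y (k + j)))‖ ^ 2 with hT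
    have hT0 : ∀ j, 0 ≤ T j := fun j => tsum_nonneg fun _ => sq_nonneg _
    have hTlim : Tendsto T atTop (𝓝 0) :=
      tendsto_sum_nat_add fun k => ‖lsqGrad A b (posPart (y k))‖ ^ 2
    have hTsucc : ∀ j, T j = ‖lsqGrad A b (posPart (y j))‖ ^ 2 + T (j + 1) := by
      intro j
      simp only [hT]
      rw [((summable_nat_add_iff j).2 hsum).tsum_eq_zero_add, zero_add]
      simp only [add_assoc, add_comm 1 j]
    obtain ⟨⟨l, hl⟩, hs⟩ := tendsto_and_summable_of_energy (N := 0)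
      (E := fun j => ‖y j - (x + q)‖ ^ 2 + 3 * Γ ^ 2 * T j)
      (D := fun j => 1 / 2 * ‖posPart (y j) - L.starProjection (posPart (y j))‖ ^ 2 +
          ‖L.starProjection (y j - posPart (y j))‖ ^ 2)
      (fun j => by have := hT0 j; positivity) (fun j _ => by positivity) (fun j _ => by
        have key := norm_sq_splitting_step_le (A := A) (b := b) (y j) (γ := γ j) hx.1.1 hx.1.2 hq
          hqx (by rw [map_add, hPq, hgx, smul_zero, map_zero, zero_add])
        rw [← hrun.update j, hgx, sub_zero, map_sub _ _ q, hPq, sub_zero] at key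
        have hin := inner_lsqGrad_sub A b (posPart (y j)) x
        rw [hgx, sub_zero] at hin
        rw [hin] at key
        have h1 := mul_self_le_mul_self
          (mul_nonneg (hrun.step_pos j).le (norm_nonneg _)) (hΓ j)
        have h2 : 0 ≤ γ j * ‖A (posPart (y j) - x)‖ ^ 2 :=
          mul_nonneg (hrun.step_pos j).le (sq_nonneg _)
        have h3 := hTsucc j
        rw [h3]
        nlinarith)
    refine ⟨⟨√l, ?_⟩, hs⟩
    have h1 := (hl.sub (hTlim.const_mul (3 * Γ ^ 2))).sqrt
    simpa [Real.sqrt_sq] using h1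
  have hD := (energy xs 0 hxs (fun _ => le_rfl) (map_zero _)).2.tendsto_atTop_zero
  refine tendsto_of_fejer hxs (fun x q hx hq hPq => (energy x q hx hq hPq).1) strictMono_id
    ?_ ?_ (by rw [hgxs]; exact hg0)
  · rw [tendsto_zero_iff_norm_tendsto_zero]
    have h1 := (hD.const_mul 2).sqrt
    rw [mul_zero, Real.sqrt_zero] at h1
    refine squeeze_zero (fun _ => norm_nonneg _) (fun k => Real.le_sqrt_of_sq_le ?_) h1
    simp only [id]
    nlinarith [sq_nonneg ‖L.starProjection (y k - posPart (y k))‖]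
  · rw [tendsto_zero_iff_norm_tendsto_zero]
    have h1 := hD.sqrt
    rw [Real.sqrt_zero] at h1
    refine squeeze_zero (fun _ => norm_nonneg _) (fun k => Real.le_sqrt_of_sq_le ?_) h1
    simp only [id]
    nlinarith [sq_nonneg ‖posPart (y k) - L.starProjection (posPart (y k))‖]

/-- Here the step sizes tend to zero and are eventually nonincreasing, but are not summable. The
first two facts give quasi-Fejér monotonicity, the last one a subsequence with the right gradient
limit. -/
theorem tendsto_of_not_summable (hrun : IsLsqRun A b L y γ)
    (hsum : ¬ Summable fun j => ‖lsqGrad A b (posPart (y j))‖ ^ 2) :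
    ∃ x, IsLsqMin A b L x ∧ Tendsto (fun j => posPart (y j)) atTop (𝓝 x) := by
  obtain ⟨xs, hxs⟩ := exists_isLsqMin A b L
  set S : ℕ → ℝ := fun n => ∑ τ ∈ Finset.range n, ‖lsqGrad A b (posPart (y τ))‖ ^ 2 with hS
  have hStop : Tendsto S atTop atTop :=
    (not_summable_iff_tendsto_nat_atTop_of_nonneg fun _ => sq_nonneg _).1 hsum
  have hSmono : Monotone S := monotone_nat_of_le_succ fun n => by
    simp only [hS, Finset.sum_range_succ]
    linarith [sq_nonneg ‖lsqGrad A b (posPart (y n))‖]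
  have hγS : ∀ᶠ j in atTop, γ j = 1 / √(S j) := by
    filter_upwards [hStop.eventually_gt_atTop 0] with j hj using hrun.step_eq j hj
  have hγ0 : Tendsto γ atTop (𝓝 0) := by
    have h1 : Tendsto (fun j => 1 / √(S j)) atTop (𝓝 0) :=
      (tendsto_const_nhds (x := (1 : ℝ))).div_atTop (Real.tendsto_sqrt_atTop.comp hStop)
    exact h1.congr' (hγS.mono fun j hj => hj.symm)
  set ℓ : ℝ := 2 * ‖A‖ ^ 2 + 1 with hℓ
  have hℓpos : 0 < ℓ := by positivity
  have hγsmall : ∀ᶠ j in atTop, γ j < 1 / (3 * ℓ) := hγ0.eventually_lt_const (by positivity)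
  obtain ⟨N, hN⟩ := eventually_atTop.1
    (hγS.and (hγsmall.and (hStop.eventually_gt_atTop 0)))
  have hγanti : ∀ j, N ≤ j → γ (j + 1) ≤ γ j := fun j hj => by
    rw [(hN j hj).1, (hN (j + 1) (by omega)).1]
    exact one_div_le_one_div_of_le (Real.sqrt_pos.2 (hN j hj).2.2)
      (Real.sqrt_le_sqrt (hSmono j.le_succ))
  have energy : ∀ x q : EuclideanSpace ℝ ι, IsLsqMin A b L x → (∀ i, q i ≤ 0) →
      L.starProjection q = 0 → (∃ l, Tendsto (fun j => ‖y j - (x + q)‖) atTop (𝓝 l)) ∧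
        ∃ v, Summable fun j => 1 / 2 * ‖posPart (y j) - L.starProjection (posPart (y j))‖ ^ 2 +
          ‖L.starProjection (y j - posPart (y j)) - γ j • L.starProjection v‖ ^ 2 +
          γ j / ℓ * ‖lsqGrad A b (posPart (y j)) - lsqGrad A b x‖ ^ 2 := by
    intro x q hx hq hPq
    obtain ⟨v, hv, hvx, hPv⟩ := hx.exists_multiplier
    have hqx : inner ℝ q x = 0 := by
      rw [← Submodule.starProjection_eq_self_iff.2 hx.1.2,
        ← L.inner_starProjection_left_eq_right, hPq, inner_zero_left]
    obtain ⟨⟨l, hl⟩, hs⟩ := tendsto_and_summable_of_energy (N := N)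
      -- The reference point moves by `(γ j - γ (j + 1)) ‖v‖` in one step, which is exactly the
      -- decrease of the added term `γ j * ‖v‖`.
      (E := fun j => (‖y j - (x + (q + γ j • v))‖ + γ j * ‖v‖) ^ 2)
      (D := fun j => 1 / 2 * ‖posPart (y j) - L.starProjection (posPart (y j))‖ ^ 2 +
          ‖L.starProjection (y j - posPart (y j)) - γ j • L.starProjection v‖ ^ 2 +
          γ j / ℓ * ‖lsqGrad A b (posPart (y j)) - lsqGrad A b x‖ ^ 2)
      (fun j => sq_nonneg _) (fun j _ => by have := (hrun.step_pos j).le; positivity)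
      (fun j hj => by
        have hγj := hrun.step_pos j
        have key := norm_sq_splitting_step_le (A := A) (b := b) (y j) (γ := γ j)
          (U := q + γ j • v) hx.1.1 hx.1.2
          (fun i => add_nonpos (hq i) (mul_nonpos_of_nonneg_of_nonpos hγj.le (hv i)))
          (by rw [inner_add_left, hqx, real_inner_smul_left, hvx, mul_zero, add_zero])
          (by rw [add_assoc, ← smul_add, map_add, hPq, map_smul, hPv, smul_zero, zero_add])
        rw [← hrun.update j, map_sub _ _ (q + γ j • v), map_add _ q, hPq, zero_add, map_smul]
          at key
        have hco := norm_lsqGrad_sub_sq_le A b (posPart (y j)) x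
        rw [← hℓ] at hco
        set e := lsqGrad A b (posPart (y j)) - lsqGrad A b x
        set c := inner ℝ (posPart (y j) - x) e
        set d₁ := ‖posPart (y j) - L.starProjection (posPart (y j))‖ ^ 2
        set d₂ := ‖L.starProjection (y j - posPart (y j)) - γ j • L.starProjection v‖ ^ 2
        have hd₁ : 0 ≤ d₁ := sq_nonneg _
        have hd₂ : 0 ≤ d₂ := sq_nonneg _
        -- Cocoercivity gives `2 γ c ≥ 2 (γ / ℓ) ‖e‖²`, and `γ < 1 / (3 ℓ)` bounds the error `3 γ²
        -- ‖e‖²` by half of this.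
        have he : γ j / ℓ * ‖e‖ ^ 2 ≤ 2 * γ j * c - 3 * γ j ^ 2 * ‖e‖ ^ 2 := by
          have h1 : ‖e‖ ^ 2 / ℓ ≤ c := (div_le_iff₀' hℓpos).2 hco
          have h2 : 3 * γ j ≤ 1 / ℓ := by
            have := (hN j hj).2.1.le
            rw [le_div_iff₀ (by positivity)] at this ⊢
            linarith
          have h3 : 3 * γ j * ‖e‖ ^ 2 ≤ 1 / ℓ * ‖e‖ ^ 2 :=
            mul_le_mul_of_nonneg_right h2 (sq_nonneg _)
          have h4 : γ j * (3 * γ j * ‖e‖ ^ 2) ≤ γ j * (1 / ℓ * ‖e‖ ^ 2) :=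
            mul_le_mul_of_nonneg_left h3 hγj.le
          have h5 : γ j * (‖e‖ ^ 2 / ℓ) ≤ γ j * c := mul_le_mul_of_nonneg_left h1 hγj.le
          have h6 : γ j * (1 / ℓ * ‖e‖ ^ 2) = γ j * (‖e‖ ^ 2 / ℓ) := by ring
          have h7 : γ j / ℓ * ‖e‖ ^ 2 = γ j * (‖e‖ ^ 2 / ℓ) := by ring
          rw [h7]
          linarith
        have he0 : 0 ≤ γ j / ℓ * ‖e‖ ^ 2 := by positivity
        set p := ‖y (j + 1) - (x + (q + γ j • v))‖
        set p₀ := ‖y j - (x + (q + γ j • v))‖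
        have hp : 0 ≤ p := norm_nonneg _
        have hp₀ : 0 ≤ p₀ := norm_nonneg _
        have hpp : p ≤ p₀ := le_of_sq_le_sq (by linarith) hp₀
        have hnext : ‖y (j + 1) - (x + (q + γ (j + 1) • v))‖ + γ (j + 1) * ‖v‖ ≤
            p + γ j * ‖v‖ := by
          have h1 : y (j + 1) - (x + (q + γ (j + 1) • v)) =
              (y (j + 1) - (x + (q + γ j • v))) + (γ j - γ (j + 1)) • v := by
            rw [sub_smul]; abel
          have h2 := norm_add_le (y (j + 1) - (x + (q + γ j • v))) ((γ j - γ (j + 1)) • v)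
          rw [← h1, norm_smul, Real.norm_eq_abs, abs_of_nonneg (sub_nonneg.2 (hγanti j hj))] at h2
          linarith
        have hnn : 0 ≤ ‖y (j + 1) - (x + (q + γ (j + 1) • v))‖ + γ (j + 1) * ‖v‖ :=
          add_nonneg (norm_nonneg _) (mul_nonneg (hrun.step_pos _).le (norm_nonneg _))
        have hsq := pow_le_pow_left₀ hnn hnext 2
        have hcross : 0 ≤ γ j * ‖v‖ * (p₀ - p) :=
          mul_nonneg (mul_nonneg hγj.le (norm_nonneg _)) (sub_nonneg.2 hpp)
        nlinarith)
    refine ⟨⟨√l, ?_⟩, v, hs⟩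
    have h1 : Tendsto (fun j => ‖y j - (x + (q + γ j • v))‖ + γ j * ‖v‖) atTop (𝓝 √l) := by
      refine hl.sqrt.congr fun j => Real.sqrt_sq ?_
      exact add_nonneg (norm_nonneg _) (mul_nonneg (hrun.step_pos _).le (norm_nonneg _))
    have h2 : Tendsto (fun j => γ j * ‖v‖) atTop (𝓝 0) := by simpa using hγ0.mul_const ‖v‖
    refine tendsto_of_tendsto_of_tendsto_of_le_of_le
      (g := fun j => ‖y j - (x + (q + γ j • v))‖ + γ j * ‖v‖ - 2 * (γ j * ‖v‖))
      (by simpa using h1.sub (h2.const_mul 2)) h1 (fun j => ?_) (fun j => ?_)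
    · have h3 := norm_sub_le (y j - (x + q)) (γ j • v)
      rw [norm_smul, Real.norm_eq_abs, abs_of_pos (hrun.step_pos j),
        show y j - (x + q) - γ j • v = y j - (x + (q + γ j • v)) by abel] at h3
      simp only
      linarith
    · have h3 := norm_add_le (y j - (x + (q + γ j • v))) (γ j • v)
      rwa [norm_smul, Real.norm_eq_abs, abs_of_pos (hrun.step_pos j),
        show y j - (x + (q + γ j • v)) + γ j • v = y j - (x + q) by abel] at h3
  obtain ⟨⟨l, hl⟩, v, hD⟩ := energy xs 0 hxs (fun _ => le_rfl) (map_zero _)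
  -- The iterates are bounded, so `S n` is at most a multiple of `n`. The cruder bound by a multiple
  -- of `n ^ 2` already makes `γ n` dominate a multiple of the harmonic series.
  have hγns : ¬ Summable γ := by
    intro hγsum
    obtain ⟨R, hR⟩ := hl.bddAbove_range
    obtain ⟨C, hC⟩ := (isCompact_closedBall (xs + 0) R).exists_bound_of_continuousOn
      (f := fun z => lsqGrad A b (posPart z))
      ((continuous_lsqGrad A b).comp continuous_posPart).continuousOn
    have hSle : ∀ n, S n ≤ n * (C ^ 2 + 1) := fun n => by
      have : ∀ τ ∈ Finset.range n, ‖lsqGrad A b (posPart (y τ))‖ ^ 2 ≤ C ^ 2 + 1 := fun τ _ => by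
        have h1 := hC (y τ) (by rw [Metric.mem_closedBall, dist_eq_norm]; exact hR ⟨τ, rfl⟩)
        have := pow_le_pow_left₀ (norm_nonneg _) h1 2
        linarith
      have hle := Finset.sum_le_card_nsmul _ _ _ this
      rwa [Finset.card_range, nsmul_eq_mul] at hle
    refine Real.not_summable_one_div_natCast ?_
    refine Summable.of_norm_bounded_eventually_nat (hγsum.mul_left √(C ^ 2 + 1)) ?_
    filter_upwards [eventually_ge_atTop N, eventually_ge_atTop 1] with n hn hn1
    have hn1' : (1 : ℝ) ≤ n := by exact_mod_cast hn1
    have hSpos := Real.sqrt_pos.2 (hN n hn).2.2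
    rw [(hN n hn).1, Real.norm_eq_abs, abs_of_nonneg (by positivity), mul_one_div,
      div_le_div_iff₀ (by linarith) hSpos, one_mul]
    calc √(S n) ≤ √((C ^ 2 + 1) * (n : ℝ) ^ 2) := Real.sqrt_le_sqrt <| (hSle n).trans <| by
          nlinarith [mul_nonneg (sub_nonneg.2 hn1') (show (0 : ℝ) ≤ C ^ 2 + 1 by positivity)]
      _ = √(C ^ 2 + 1) * n := by rw [Real.sqrt_mul (by positivity), Real.sqrt_sq (by linarith)]
  -- The terms `γ k / ℓ * ‖e‖ ^ 2` are summable; if the gradient error stayed away from zero, `γ`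
  -- would be summable too.
  have hfreq : ∀ n : ℕ, ∃ᶠ k in atTop,
      ‖lsqGrad A b (posPart (y k)) - lsqGrad A b xs‖ < 1 / ((n : ℝ) + 1) := by
    intro n
    by_contra hcon
    rw [not_frequently] at hcon
    refine hγns (Summable.of_norm_bounded_eventually_nat (hD.mul_left (ℓ * ((n : ℝ) + 1) ^ 2)) ?_)
    filter_upwards [hcon] with k hk
    have h1 : 1 ≤ ((n : ℝ) + 1) * ‖lsqGrad A b (posPart (y k)) - lsqGrad A b xs‖ := by
      rw [not_lt, div_le_iff₀ (by positivity)] at hk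
      linarith
    have h2 := one_le_pow₀ (n := 2) h1
    have hγk := hrun.step_pos k
    rw [Real.norm_eq_abs, abs_of_pos hγk]
    calc γ k ≤ γ k * (((n : ℝ) + 1) * ‖lsqGrad A b (posPart (y k)) - lsqGrad A b xs‖) ^ 2 :=
          le_mul_of_one_le_right hγk.le h2
      _ = ℓ * ((n : ℝ) + 1) ^ 2 *
          (γ k / ℓ * ‖lsqGrad A b (posPart (y k)) - lsqGrad A b xs‖ ^ 2) := by
        field_simp
      _ ≤ _ := by
        refine mul_le_mul_of_nonneg_left ?_ (by positivity)
        have : 0 ≤ 1 / 2 * ‖posPart (y k) - L.starProjection (posPart (y k))‖ ^ 2 +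
          ‖L.starProjection (y k - posPart (y k)) - γ k • L.starProjection v‖ ^ 2 := by positivity
        linarith
  obtain ⟨φ, hφ, hφg⟩ := extraction_forall_of_frequently hfreq
  have hD0 := hD.tendsto_atTop_zero
  have hnn : ∀ k, 0 ≤ γ k / ℓ * ‖lsqGrad A b (posPart (y k)) - lsqGrad A b xs‖ ^ 2 := fun k => by
    have := (hrun.step_pos k).le
    positivity
  refine tendsto_of_fejer hxs (fun x q hx hq hPq => (energy x q hx hq hPq).1) hφ ?_ ?_ ?_
  · refine Tendsto.comp (g := fun k => posPart (y k) - L.starProjection (posPart (y k))) ?_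
      hφ.tendsto_atTop
    rw [tendsto_zero_iff_norm_tendsto_zero]
    have h1 := (hD0.const_mul 2).sqrt
    rw [mul_zero, Real.sqrt_zero] at h1
    refine squeeze_zero (fun _ => norm_nonneg _) (fun k => Real.le_sqrt_of_sq_le ?_) h1
    have := hnn k
    nlinarith [sq_nonneg ‖L.starProjection (y k - posPart (y k)) - γ k • L.starProjection v‖]
  · refine Tendsto.comp (g := fun k => L.starProjection (y k - posPart (y k))) ?_ hφ.tendsto_atTop
    have h1 : Tendsto (fun k => L.starProjection (y k - posPart (y k)) -
        γ k • L.starProjection v) atTop (𝓝 0) := by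
      rw [tendsto_zero_iff_norm_tendsto_zero]
      have h1 := hD0.sqrt
      rw [Real.sqrt_zero] at h1
      refine squeeze_zero (fun _ => norm_nonneg _) (fun k => Real.le_sqrt_of_sq_le ?_) h1
      have := hnn k
      nlinarith [sq_nonneg ‖posPart (y k) - L.starProjection (posPart (y k))‖]
    simpa using h1.add (hγ0.smul_const (L.starProjection v))
  · rw [tendsto_iff_norm_sub_tendsto_zero]
    exact squeeze_zero (fun _ => norm_nonneg _) (fun k => (hφg k).le)
      tendsto_one_div_add_atTop_nhds_zero_nat

/-- The iterates of three operator splitting converge to a minimizer. -/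
theorem tendsto_isLsqMin (hrun : IsLsqRun A b L y γ) :
    ∃ x, IsLsqMin A b L x ∧ Tendsto (fun j => posPart (y j)) atTop (𝓝 x) := by
  by_cases hsum : Summable fun j => ‖lsqGrad A b (posPart (y j))‖ ^ 2
  · exact hrun.tendsto_of_summable hsum
  · exact hrun.tendsto_of_not_summable hsum

end IsLsqRun

end Splitting

/-! ### Matrices as Euclidean vectors -/

section Transfer

/-- A matrix as a vector with the Euclidean norm. -/
def toEuc {m n : Type*} : Matrix m n ℝ ≃ₗ[ℝ] EuclideanSpace ℝ (m × n) where
  toFun H := WithLp.toLp 2 fun p => H p.1 p.2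
  invFun x := Matrix.of fun s t => x (s, t)
  map_add' _ _ := rfl
  map_smul' _ _ := rfl
  left_inv _ := rfl
  right_inv _ := rfl

@[simp]
theorem toEuc_apply {m n : Type*} (H : Matrix m n ℝ) (p : m × n) : toEuc H p = H p.1 p.2 := rfl

@[simp]
theorem toEuc_symm_apply {m n : Type*} (x : EuclideanSpace ℝ (m × n)) (s : m) (t : n) :
    toEuc.symm x s t = x (s, t) := rfl

theorem continuous_toEuc {m n : Type*} : Continuous (toEuc : Matrix m n ℝ → _) := by
  change Continuous fun H : Matrix m n ℝ => WithLp.toLp 2 fun p : m × n => H p.1 p.2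
  fun_prop

theorem continuous_toEuc_symm {m n : Type*} :
    Continuous (toEuc.symm : EuclideanSpace ℝ (m × n) → Matrix m n ℝ) :=
  continuous_matrix fun s t => by
    simp only [toEuc_symm_apply]
    fun_prop

theorem frobSq_eq_norm_sq {m n : Type*} [Fintype m] [Fintype n] (H : Matrix m n ℝ) :
    frobSq H = ‖toEuc H‖ ^ 2 := by
  simp [frobSq, EuclideanSpace.norm_sq_eq, Fintype.sum_prod_type]

theorem frobSq_nonneg {m n : Type*} [Fintype m] [Fintype n] (H : Matrix m n ℝ) : 0 ≤ frobSq H := by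
  rw [frobSq_eq_norm_sq]
  positivity

/-- `f` is a sum of squares of affine functions of the entries of a matrix. -/
def IsLsqFun {m n : Type*} [Fintype m] [Fintype n] (f : Matrix m n ℝ → ℝ) : Prop :=
  ∃ (κ : Type) (_ : Fintype κ) (A : EuclideanSpace ℝ (m × n) →L[ℝ] EuclideanSpace ℝ κ)
    (b : EuclideanSpace ℝ κ), ∀ H, f H = ‖A (toEuc H) - b‖ ^ 2

/-- Stacking the two residual vectors makes a sum of least squares terms a single one. -/
theorem IsLsqFun.add {m n : Type*} [Fintype m] [Fintype n] {f g : Matrix m n ℝ → ℝ}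
    (hf : IsLsqFun f) (hg : IsLsqFun g) : IsLsqFun fun H => f H + g H := by
  obtain ⟨κ, _, A, b, hA⟩ := hf
  obtain ⟨κ', _, A', b', hA'⟩ := hg
  let B : EuclideanSpace ℝ (m × n) →ₗ[ℝ] EuclideanSpace ℝ (κ ⊕ κ') :=
    { toFun := fun x => WithLp.toLp 2 (Sum.elim (A x) (A' x))
      map_add' := fun x y => by
        ext i
        rcases i with i | i <;> simp
      map_smul' := fun c x => by
        ext i
        rcases i with i | i <;> simp }
  refine ⟨κ ⊕ κ', inferInstance, LinearMap.toContinuousLinearMap B,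
    WithLp.toLp 2 (Sum.elim b b'), fun H => ?_⟩
  simp only [hA, hA']
  rw [EuclideanSpace.norm_sq_eq, EuclideanSpace.norm_sq_eq, EuclideanSpace.norm_sq_eq,
    Fintype.sum_sum_type]
  simp [B]

theorem IsLsqFun.const_mul {m n : Type*} [Fintype m] [Fintype n] {f : Matrix m n ℝ → ℝ}
    (hf : IsLsqFun f) {c : ℝ} (hc : 0 ≤ c) : IsLsqFun fun H => c * f H := by
  obtain ⟨κ, _, A, b, hA⟩ := hf
  refine ⟨κ, inferInstance, √c • A, √c • b, fun H => ?_⟩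
  simp only [hA]
  rw [smul_apply, ← smul_sub, norm_smul, mul_pow, Real.norm_eq_abs, sq_abs,
    Real.sq_sqrt hc]

theorem isLsqFun_frobSq_sub {m n p q : Type} [Fintype m] [Fintype n] [Fintype p] [Fintype q]
    (X : Matrix p q ℝ) (B : Matrix m n ℝ →ₗ[ℝ] Matrix p q ℝ) :
    IsLsqFun fun H => frobSq (X - B H) := by
  refine ⟨p × q, inferInstance, LinearMap.toContinuousLinearMap
    (toEuc.toLinearMap.comp (B.comp toEuc.symm.toLinearMap)), toEuc X, fun H => ?_⟩
  simp only [frobSq_eq_norm_sq, map_sub]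
  rw [norm_sub_rev]
  simp

theorem isLsqFun_frobSq {m n : Type} [Fintype m] [Fintype n] :
    IsLsqFun (frobSq : Matrix m n ℝ → ℝ) := by
  refine ⟨m × n, inferInstance, ContinuousLinearMap.id ℝ _, 0, fun H => ?_⟩
  simp [frobSq_eq_norm_sq]

theorem isLsqFun_frobSq_sub_mul {m n : ℕ} {p : Type} [Fintype p] (X : Matrix p (Fin n) ℝ)
    (W : Matrix p (Fin m) ℝ) : IsLsqFun fun H : Matrix (Fin m) (Fin n) ℝ => frobSq (X - W * H) :=
  isLsqFun_frobSq_sub X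
    { toFun := fun H => W * H
      map_add' := fun _ _ => Matrix.mul_add _ _ _
      map_smul' := fun _ _ => Matrix.mul_smul _ _ _ }

theorem isLsqFun_frobSq_sub_mul_right {m n : ℕ} {p : Type} [Fintype p] (X : Matrix p (Fin n) ℝ)
    (H : Matrix (Fin m) (Fin n) ℝ) : IsLsqFun fun W : Matrix p (Fin m) ℝ => frobSq (X - W * H) :=
  isLsqFun_frobSq_sub X
    { toFun := fun W => W * H
      map_add' := fun _ _ => Matrix.add_mul _ _ _
      map_smul' := fun _ _ => Matrix.smul_mul _ _ _ }

theorem IsLsqFun.exists_isArgmin_univ {m n : Type*} [Fintype m] [Fintype n] {f : Matrix m n ℝ → ℝ}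
    (hf : IsLsqFun f) : ∃ W, IsArgmin f Set.univ W := by
  obtain ⟨κ, _, A, b, hA⟩ := hf
  have hcl : IsClosed (LinearMap.range A.toLinearMap : Set (EuclideanSpace ℝ κ)) :=
    Submodule.closed_of_finiteDimensional _
  obtain ⟨w, ⟨x, rfl⟩, hdist⟩ := hcl.exists_infDist_eq_dist ⟨0, Submodule.zero_mem _⟩ b
  refine ⟨toEuc.symm x, trivial, fun Z _ => ?_⟩
  have := Metric.infDist_le_dist_of_mem (x := b)
    (show A.toLinearMap (toEuc Z) ∈ (LinearMap.range A.toLinearMap : Set _) from ⟨_, rfl⟩)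
  rw [hdist, dist_comm, dist_eq_norm, dist_comm, dist_eq_norm] at this
  rw [hA, hA, LinearEquiv.apply_symm_apply]
  exact pow_le_pow_left₀ (norm_nonneg _) this 2

theorem isLsqFun_codingObj {d r T : ℕ} (X Y : Matrix (Fin d) (Fin T) ℝ) {ξ lam : ℝ} (hξ : 0 ≤ ξ)
    (hlam : 0 ≤ lam) (W W' : Matrix (Fin d) (Fin r) ℝ) : IsLsqFun (codingObj X Y ξ lam W W') :=
  ((isLsqFun_frobSq_sub_mul X W).add ((isLsqFun_frobSq_sub_mul Y W').const_mul hξ)).add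
    (isLsqFun_frobSq.const_mul hlam)

variable {r T : ℕ}

/-- The matrices with frequencies in `K`, as a subspace. -/
def freqSubmodule (r : ℕ) {T : ℕ} (K : Set (Fin T)) :
    Submodule ℝ (EuclideanSpace ℝ (Fin r × Fin T)) where
  carrier := {x | toEuc.symm x ∈ freqSet r K}
  zero_mem' := fun s k _ => by simp [rowDFT]
  add_mem' := fun {x y} hx hy s k hk => by
    have h1 := hx s k hk
    have h2 := hy s k hk
    simp only [rowDFT, Matrix.of_apply, toEuc_symm_apply] at h1 h2 ⊢
    simp only [PiLp.add_apply, Complex.ofReal_add, add_mul, Finset.sum_add_distrib, mul_add, h1,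
      h2, add_zero]
  smul_mem' := fun c x hx s k hk => by
    have h1 := hx s k hk
    simp only [rowDFT, Matrix.of_apply, toEuc_symm_apply] at h1 ⊢
    simp only [PiLp.smul_apply, smul_eq_mul, Complex.ofReal_mul, mul_assoc]
    rw [← Finset.mul_sum, mul_left_comm]
    simp only [mul_assoc] at h1
    rw [h1, mul_zero]

theorem toEuc_mem_freqSubmodule {K : Set (Fin T)} {H : Matrix (Fin r) (Fin T) ℝ} :
    toEuc H ∈ freqSubmodule r K ↔ H ∈ freqSet r K := Iff.rfl

/-- The hypothesis `hS` is the obtuse angle property of a projection. Through it, the variational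
description of the proximal steps becomes an explicit formula, unique minimizer included. -/
theorem isArgmin_half_frobSq_iff {m n : Type*} [Fintype m] [Fintype n] {S : Set (Matrix m n ℝ)}
    {Y H : Matrix m n ℝ} {p : EuclideanSpace ℝ (m × n)} (hp : toEuc.symm p ∈ S)
    (hS : ∀ Z ∈ S, ‖toEuc Y - p‖ ^ 2 + ‖p - toEuc Z‖ ^ 2 ≤ ‖toEuc Y - toEuc Z‖ ^ 2) :
    IsArgmin (fun Z => (1 / 2) * frobSq (Y - Z)) S H ↔ toEuc H = p := by
  simp only [IsArgmin, frobSq_eq_norm_sq, map_sub]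
  constructor
  · rintro ⟨hH, hmin⟩
    have h1 := hmin _ hp
    rw [LinearEquiv.apply_symm_apply] at h1
    have h2 := hS H hH
    have h3 : ‖p - toEuc H‖ = 0 := by nlinarith [norm_nonneg (p - toEuc H)]
    exact (sub_eq_zero.1 (norm_eq_zero.1 h3)).symm
  · intro h
    obtain rfl : H = toEuc.symm p := by rw [← h, LinearEquiv.symm_apply_apply]
    refine ⟨hp, fun Z hZ => ?_⟩
    rw [LinearEquiv.apply_symm_apply]
    nlinarith [hS Z hZ, sq_nonneg ‖p - toEuc Z‖]

theorem isArgmin_nonnegSet_iff {Y H : Matrix (Fin r) (Fin T) ℝ} :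
    IsArgmin (fun Z => (1 / 2) * frobSq (Y - Z)) (nonnegSet r T) H ↔
      toEuc H = posPart (toEuc Y) := by
  refine isArgmin_half_frobSq_iff (fun s t => posPart_nonneg _ _) fun Z hZ => ?_
  have h1 := inner_nonpos_of_nonpos (sub_posPart_nonpos (toEuc Y)) (x := toEuc Z)
    (fun i => hZ i.1 i.2)
  have h2 := inner_sub_posPart (toEuc Y)
  have h3 := norm_add_sq_real (toEuc Y - posPart (toEuc Y)) (posPart (toEuc Y) - toEuc Z)
  rw [sub_add_sub_cancel, inner_sub_right, h2] at h3
  linarith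

theorem isArgmin_freqSet_iff {K : Set (Fin T)} {Y H : Matrix (Fin r) (Fin T) ℝ} :
    IsArgmin (fun Z => (1 / 2) * frobSq (Y - Z)) (freqSet r K) H ↔
      toEuc H = (freqSubmodule r K).starProjection (toEuc Y) := by
  refine isArgmin_half_frobSq_iff
    ((freqSubmodule r K).starProjection_apply_mem (toEuc Y)) fun Z hZ => ?_
  have h2 : inner ℝ (toEuc Y - (freqSubmodule r K).starProjection (toEuc Y))
      ((freqSubmodule r K).starProjection (toEuc Y) - toEuc Z) = 0 :=
    (freqSubmodule r K).starProjection_inner_eq_zero _ _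
      (Submodule.sub_mem _ ((freqSubmodule r K).starProjection_apply_mem _)
        (toEuc_mem_freqSubmodule.2 hZ))
  have h3 := norm_add_sq_real (toEuc Y - (freqSubmodule r K).starProjection (toEuc Y))
    ((freqSubmodule r K).starProjection (toEuc Y) - toEuc Z)
  rw [sub_add_sub_cancel, h2] at h3
  linarith

/-! ### Splitting runs for matrices -/

variable {κ : Type*} [Fintype κ] {f : Matrix (Fin r) (Fin T) ℝ → ℝ}
  {A : EuclideanSpace ℝ (Fin r × Fin T) →L[ℝ] EuclideanSpace ℝ κ} {b : EuclideanSpace ℝ κ}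

theorem toEuc_matGrad (hf : ∀ H, f H = ‖A (toEuc H) - b‖ ^ 2) (H : Matrix (Fin r) (Fin T) ℝ) :
    toEuc (matGrad f H) = lsqGrad A b (toEuc H) := by
  ext ⟨s, t⟩
  have hsingle : toEuc (Matrix.single s t (1 : ℝ)) = EuclideanSpace.single (s, t) 1 := by
    ext ⟨s', t'⟩
    simp [Matrix.single, eq_comm]
  have h1 : (fun u : ℝ => f (H + u • Matrix.single s t (1 : ℝ))) = fun u =>
      ‖A (toEuc H) - b‖ ^ 2 + u * lsqGrad A b (toEuc H) (s, t) +
        u ^ 2 * ‖A (EuclideanSpace.single (s, t) 1)‖ ^ 2 := by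
    funext u
    rw [hf, map_add, map_smul, hsingle, lsq_add_smul, EuclideanSpace.inner_single_right]
    simp
  change deriv (fun u : ℝ => f (H + u • Matrix.single s t (1 : ℝ))) 0 = _
  rw [h1]
  have h2 := (((hasDerivAt_id (0 : ℝ)).mul_const (lsqGrad A b (toEuc H) (s, t))).const_add
    (‖A (toEuc H) - b‖ ^ 2)).add
    (((hasDerivAt_id (0 : ℝ)).pow 2).mul_const (‖A (EuclideanSpace.single (s, t) 1)‖ ^ 2))
  refine (h2.congr_deriv ?_).deriv
  simp

theorem isArgmin_hardSet_iff (hf : ∀ H, f H = ‖A (toEuc H) - b‖ ^ 2) {K : Set (Fin T)}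
    {x : EuclideanSpace ℝ (Fin r × Fin T)} :
    IsArgmin f (hardSet r K) (toEuc.symm x) ↔ IsLsqMin A b (freqSubmodule r K) x := by
  constructor
  · rintro ⟨⟨h1, h2⟩, h3⟩
    refine ⟨⟨fun i => h1 i.1 i.2, h2⟩, fun z hz hzK => ?_⟩
    have := h3 (toEuc.symm z) ⟨fun s t => hz (s, t), hzK⟩
    rwa [hf, hf, LinearEquiv.apply_symm_apply, LinearEquiv.apply_symm_apply] at this
  · rintro ⟨⟨h1, h2⟩, h3⟩
    refine ⟨⟨fun s t => h1 (s, t), h2⟩, fun Z hZ => ?_⟩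
    rw [hf, hf, LinearEquiv.apply_symm_apply]
    exact h3 (toEuc Z) (fun i => hZ.1 i.1 i.2) hZ.2

theorem IsTOSRun.isLsqRun (hf : ∀ H, f H = ‖A (toEuc H) - b‖ ^ 2) {K : Set (Fin T)}
    {y H G : ℕ → Matrix (Fin r) (Fin T) ℝ} {γ : ℕ → ℝ} (hrun : IsTOSRun f K y H G γ) :
    IsLsqRun A b (freqSubmodule r K) (fun j => toEuc (y j)) γ := by
  have hH := fun j => isArgmin_nonnegSet_iff.1 (hrun.H_update j)
  have hG := fun j => isArgmin_freqSet_iff.1 (hrun.G_update j)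
  have hgrad : ∀ j, frobSq (matGrad f (H j)) = ‖lsqGrad A b (posPart (toEuc (y j)))‖ ^ 2 :=
    fun j => by rw [frobSq_eq_norm_sq, toEuc_matGrad hf, hH]
  refine ⟨hrun.step_pos, fun j => ?_, fun j => ?_⟩
  · simpa only [hgrad] using hrun.step_eq j
  · have h : toEuc ((2 : ℝ) • H j - y j - γ j • matGrad f (H j)) = (2 : ℝ) • posPart (toEuc (y j)) -
        toEuc (y j) - γ j • lsqGrad A b (posPart (toEuc (y j))) := by
      rw [map_sub, map_sub, map_smul, map_smul, toEuc_matGrad hf, hH]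
    rw [hrun.y_update j, map_add, map_sub, hG, h, hH]

theorem exists_isTOSRun (f : Matrix (Fin r) (Fin T) ℝ → ℝ) (K : Set (Fin T))
    (y₀ : Matrix (Fin r) (Fin T) ℝ) :
    ∃ (y H G : ℕ → Matrix (Fin r) (Fin T) ℝ) (γ : ℕ → ℝ), y 0 = y₀ ∧ IsTOSRun f K y H G γ := by
  classical
  let h : Matrix (Fin r) (Fin T) ℝ → Matrix (Fin r) (Fin T) ℝ :=
    fun Y => toEuc.symm (posPart (toEuc Y))
  -- The state carries the accumulated squared gradient norms along with `y`; while they vanish, the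
  -- free step size is chosen to be `1`.
  let step : ℝ → ℝ := fun S => if 0 < S then 1 / √S else 1
  let G : Matrix (Fin r) (Fin T) ℝ × ℝ → Matrix (Fin r) (Fin T) ℝ := fun p =>
    toEuc.symm ((freqSubmodule r K).starProjection
      (toEuc ((2 : ℝ) • h p.1 - p.1 - step p.2 • matGrad f (h p.1))))
  let next : Matrix (Fin r) (Fin T) ℝ × ℝ → Matrix (Fin r) (Fin T) ℝ × ℝ := fun p =>
    (p.1 - h p.1 + G p, p.2 + frobSq (matGrad f (h p.1)))
  let st : ℕ → Matrix (Fin r) (Fin T) ℝ × ℝ := fun n => next^[n] (y₀, 0)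
  have hst : ∀ n, st (n + 1) = next (st n) := fun n => Function.iterate_succ_apply' _ _ _
  have hS : ∀ n, (st n).2 = ∑ τ ∈ Finset.range n, frobSq (matGrad f (h (st τ).1)) := by
    intro n
    induction n with
    | zero => rfl
    | succ n ih => rw [hst, Finset.sum_range_succ, ← ih]
  refine ⟨fun n => (st n).1, fun n => h (st n).1, fun n => G (st n), fun n => step (st n).2, rfl,
    fun j => ?_, fun j hj => ?_, fun j => ?_, fun j => ?_, fun j => ?_⟩
  · by_cases hp : 0 < (st j).2
    · simp only [step, if_pos hp]
      exact one_div_pos.2 (Real.sqrt_pos.2 hp)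
    · simp only [step, if_neg hp]
      exact one_pos
  · rw [← hS] at hj ⊢
    exact if_pos hj
  · exact isArgmin_nonnegSet_iff.2 (LinearEquiv.apply_symm_apply _ _)
  · exact isArgmin_freqSet_iff.2 (LinearEquiv.apply_symm_apply _ _)
  · simp only [hst, next]

theorem tendsto_ergodic {H : ℕ → Matrix (Fin r) (Fin T) ℝ} {x : EuclideanSpace ℝ (Fin r × Fin T)}
    (h : Tendsto (fun j => toEuc (H j)) atTop (𝓝 x)) :
    Tendsto (ergodic H) atTop (𝓝 (toEuc.symm x)) := by
  have h1 := (continuous_toEuc_symm.tendsto x).comp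
    (h.cesaro_smul.comp (tendsto_add_atTop_nat 1))
  refine h1.congr fun n => ?_
  simp [ergodic, map_sum]

theorem IsLsqFun.tosSolves {f : Matrix (Fin r) (Fin T) ℝ → ℝ} (hf : IsLsqFun f)
    (K : Set (Fin T)) : TOSSolves f K := by
  obtain ⟨κ, _, A, b, hA⟩ := hf
  refine fun y₀ => ⟨exists_isTOSRun f K y₀, fun y H G γ _ hrun => ?_⟩
  obtain ⟨x, hx, hlim⟩ := (hrun.isLsqRun hA).tendsto_isLsqMin
  refine ⟨toEuc.symm x, (isArgmin_hardSet_iff hA).2 hx, tendsto_ergodic ?_⟩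
  simpa only [isArgmin_nonnegSet_iff.1 (hrun.H_update _)] using hlim

end Transfer

/-! ### Alternating minimization -/

section Alternating

variable {d r T : ℕ}

/-- The residual `X - W * H` is bilinear in the factors, hence quadratic in the parameter along a
line; its second-order part does not affect the derivative at `0`. -/
theorem hasDerivAt_frobSq_quadratic {m n : Type*} [Fintype m] [Fintype n] (A B C : Matrix m n ℝ) :
    HasDerivAt (fun u : ℝ => frobSq (A + u • B + u ^ 2 • C))
      (2 * inner ℝ (toEuc A) (toEuc B)) 0 := by
  have h : HasDerivAt (fun u : ℝ => toEuc A + u • toEuc B + u ^ 2 • toEuc C) (toEuc B) 0 := by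
    have := (((hasDerivAt_id (0 : ℝ)).smul_const (toEuc B)).const_add (toEuc A)).add
      (((hasDerivAt_id (0 : ℝ)).pow 2).smul_const (toEuc C))
    refine this.congr_deriv ?_
    simp
  have h2 := h.norm_sq
  simp only [zero_smul, add_zero, ne_eq, OfNat.ofNat_ne_zero, not_false_eq_true, zero_pow] at h2
  simpa only [frobSq_eq_norm_sq, map_add, map_smul] using h2

/-- The derivative of `‖X - W H‖²` at `(H, W)` in the direction `(dH, dW)`. -/
noncomputable def fitDeriv (X : Matrix (Fin d) (Fin T) ℝ) (H : Matrix (Fin r) (Fin T) ℝ)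
    (W : Matrix (Fin d) (Fin r) ℝ) (dH : Matrix (Fin r) (Fin T) ℝ)
    (dW : Matrix (Fin d) (Fin r) ℝ) : ℝ :=
  2 * inner ℝ (toEuc (X - W * H)) (toEuc (-(W * dH + dW * H)))

theorem fitDeriv_eq_add (X : Matrix (Fin d) (Fin T) ℝ) (H : Matrix (Fin r) (Fin T) ℝ)
    (W : Matrix (Fin d) (Fin r) ℝ) (dH : Matrix (Fin r) (Fin T) ℝ)
    (dW : Matrix (Fin d) (Fin r) ℝ) :
    fitDeriv X H W dH dW = fitDeriv X H W dH 0 + fitDeriv X H W 0 dW := by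
  simp only [fitDeriv, Matrix.zero_mul, Matrix.mul_zero, add_zero, zero_add, neg_add, map_add,
    inner_add_right]
  ring

theorem hasDerivAt_fit (X : Matrix (Fin d) (Fin T) ℝ) (H : Matrix (Fin r) (Fin T) ℝ)
    (W : Matrix (Fin d) (Fin r) ℝ) (dH : Matrix (Fin r) (Fin T) ℝ)
    (dW : Matrix (Fin d) (Fin r) ℝ) :
    HasDerivAt (fun u : ℝ => frobSq (X - (W + u • dW) * (H + u • dH))) (fitDeriv X H W dH dW) 0 := by
  have h := hasDerivAt_frobSq_quadratic (X - W * H) (-(W * dH + dW * H)) (-(dW * dH))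
  refine h.congr_of_eventuallyEq (Eventually.of_forall fun u => ?_)
  simp only
  congr 1
  simp only [Matrix.add_mul, Matrix.mul_add, Matrix.smul_mul, Matrix.mul_smul, smul_neg, smul_add,
    smul_smul, pow_two]
  abel

theorem hasDerivAt_frobSq_line {m n : Type*} [Fintype m] [Fintype n] (A B : Matrix m n ℝ) :
    HasDerivAt (fun u : ℝ => frobSq (A + u • B)) (2 * inner ℝ (toEuc A) (toEuc B)) 0 := by
  simpa using hasDerivAt_frobSq_quadratic A B 0

/-- The derivative of the objective at `(H, W, W')` in the direction `(dH, dW, dW')`. -/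
noncomputable def objectiveDeriv (X Y : Matrix (Fin d) (Fin T) ℝ) (ξ lam mu nu : ℝ)
    (H : Matrix (Fin r) (Fin T) ℝ) (W W' : Matrix (Fin d) (Fin r) ℝ)
    (dH : Matrix (Fin r) (Fin T) ℝ) (dW dW' : Matrix (Fin d) (Fin r) ℝ) : ℝ :=
  fitDeriv X H W dH dW + ξ * fitDeriv Y H W' dH dW' + lam * (2 * inner ℝ (toEuc H) (toEuc dH)) +
    mu * (2 * inner ℝ (toEuc W) (toEuc dW)) + nu * (2 * inner ℝ (toEuc W') (toEuc dW'))

variable (X Y : Matrix (Fin d) (Fin T) ℝ) (ξ lam mu nu : ℝ) (K : Set (Fin T))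

/-- The derivative is additive in the direction, so variations of `H` and of `(W, W')` can be
treated separately although the objective couples them. -/
theorem objectiveDeriv_eq_add (H : Matrix (Fin r) (Fin T) ℝ) (W W' : Matrix (Fin d) (Fin r) ℝ)
    (dH : Matrix (Fin r) (Fin T) ℝ) (dW dW' : Matrix (Fin d) (Fin r) ℝ) :
    objectiveDeriv X Y ξ lam mu nu H W W' dH dW dW' =
      objectiveDeriv X Y ξ lam mu nu H W W' dH 0 0 +
        objectiveDeriv X Y ξ lam mu nu H W W' 0 dW dW' := by
  simp only [objectiveDeriv]
  rw [fitDeriv_eq_add X H W dH dW, fitDeriv_eq_add Y H W' dH dW', map_zero, map_zero,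
    inner_zero_right, inner_zero_right, inner_zero_right]
  ring

theorem hasDerivAt_objective (H : Matrix (Fin r) (Fin T) ℝ) (W W' : Matrix (Fin d) (Fin r) ℝ)
    (dH : Matrix (Fin r) (Fin T) ℝ) (dW dW' : Matrix (Fin d) (Fin r) ℝ) :
    HasDerivAt (fun u : ℝ => objective X Y ξ lam mu nu (H + u • dH) (W + u • dW) (W' + u • dW'))
      (objectiveDeriv X Y ξ lam mu nu H W W' dH dW dW') 0 :=
  ((((hasDerivAt_fit X H W dH dW).add ((hasDerivAt_fit Y H W' dH dW').const_mul ξ)).add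
    ((hasDerivAt_frobSq_line H dH).const_mul lam)).add
      ((hasDerivAt_frobSq_line W dW).const_mul mu)).add
        ((hasDerivAt_frobSq_line W' dW').const_mul nu)

theorem nonneg_of_hasDerivAt_of_le {φ : ℝ → ℝ} {D : ℝ} (h : HasDerivAt φ D 0)
    (hφ : ∀ u, 0 < u → u ≤ 1 → φ 0 ≤ φ u) : 0 ≤ D := by
  refine ge_of_tendsto h.tendsto_slope_zero_right ?_
  filter_upwards [Ioc_mem_nhdsGT (zero_lt_one (α := ℝ))] with t ht
  rw [zero_add, smul_eq_mul]
  exact mul_nonneg (inv_nonneg.2 ht.1.le) (sub_nonneg.2 (hφ t ht.1 ht.2))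

variable {K} in
theorem add_smul_sub_mem_hardSet {H H₁ : Matrix (Fin r) (Fin T) ℝ} (hH : H ∈ hardSet r K)
    (hH₁ : H₁ ∈ hardSet r K) {u : ℝ} (hu0 : 0 ≤ u) (hu1 : u ≤ 1) :
    H + u • (H₁ - H) ∈ hardSet r K := by
  refine ⟨fun s t => ?_, ?_⟩
  · have h1 := mul_nonneg (sub_nonneg.2 hu1) (hH.1 s t)
    have h2 := mul_nonneg hu0 (hH₁.1 s t)
    simp only [Matrix.add_apply, Matrix.smul_apply, Matrix.sub_apply, smul_eq_mul]
    linarith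
  · rw [← toEuc_mem_freqSubmodule, map_add, map_smul, map_sub]
    exact Submodule.add_mem _ (toEuc_mem_freqSubmodule.2 hH.2) (Submodule.smul_mem _ _
      (Submodule.sub_mem _ (toEuc_mem_freqSubmodule.2 hH₁.2) (toEuc_mem_freqSubmodule.2 hH.2)))

variable {X Y ξ lam mu nu K}

/-- Blockwise minimality implies stationarity. -/
theorem isStationary_of_block_min {H : Matrix (Fin r) (Fin T) ℝ} {W W' : Matrix (Fin d) (Fin r) ℝ}
    (hmem : H ∈ hardSet r K)
    (hH : ∀ H₁ ∈ hardSet r K,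
      objective X Y ξ lam mu nu H W W' ≤ objective X Y ξ lam mu nu H₁ W W')
    (hW : ∀ W₁ W₁', objective X Y ξ lam mu nu H W W' ≤ objective X Y ξ lam mu nu H W₁ W₁') :
    IsStationary X Y ξ lam mu nu K H W W' := by
  refine ⟨hmem, fun H₁ hH₁ W₁ W₁' => ?_⟩
  rw [(hasDerivAt_objective X Y ξ lam mu nu H W W' _ _ _).deriv, objectiveDeriv_eq_add]
  refine add_nonneg
    (nonneg_of_hasDerivAt_of_le (hasDerivAt_objective X Y ξ lam mu nu H W W' _ _ _)
      fun u hu0 hu1 => ?_)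
    (nonneg_of_hasDerivAt_of_le (hasDerivAt_objective X Y ξ lam mu nu H W W' _ _ _)
      fun u _ _ => ?_)
  · simpa using hH _ (add_smul_sub_mem_hardSet hmem hH₁ hu0.le hu1)
  · simpa using hW (W + u • (W₁ - W)) (W' + u • (W₁' - W'))

theorem continuous_frobSq {m n : Type*} [Fintype m] [Fintype n] :
    Continuous (frobSq : Matrix m n ℝ → ℝ) := by
  simp only [funext frobSq_eq_norm_sq]
  exact continuous_toEuc.norm.pow 2

theorem continuous_objective {α : Type*} [TopologicalSpace α] {H : α → Matrix (Fin r) (Fin T) ℝ}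
    {W W' : α → Matrix (Fin d) (Fin r) ℝ} (hH : Continuous H) (hW : Continuous W)
    (hW' : Continuous W') :
    Continuous fun a => objective X Y ξ lam mu nu (H a) (W a) (W' a) := by
  unfold objective codingObj
  have h1 := continuous_frobSq.comp (continuous_const (y := X) |>.sub (hW.matrix_mul hH))
  have h2 := continuous_frobSq.comp (continuous_const (y := Y) |>.sub (hW'.matrix_mul hH))
  exact (((h1.add (h2.const_mul ξ)).add ((continuous_frobSq.comp hH).const_mul lam)).add
    ((continuous_frobSq.comp hW).const_mul mu)).add ((continuous_frobSq.comp hW').const_mul nu)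

theorem isClosed_hardSet : IsClosed (hardSet r K) := by
  have h1 : IsClosed (nonnegSet r T) := by
    simp only [nonnegSet, Set.ofPred_forall]
    exact isClosed_iInter fun s => isClosed_iInter fun t =>
      isClosed_le continuous_const (by fun_prop)
  have h2 : IsClosed (freqSet r K) :=
    (Submodule.closed_of_finiteDimensional (freqSubmodule r K)).preimage continuous_toEuc
  exact h1.inter h2

theorem weighted_frobSq_le_objective (hξ : 0 ≤ ξ) (H : Matrix (Fin r) (Fin T) ℝ)
    (W W' : Matrix (Fin d) (Fin r) ℝ) :
    lam * frobSq H + mu * frobSq W + nu * frobSq W' ≤ objective X Y ξ lam mu nu H W W' := by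
  have h1 := frobSq_nonneg (X - W * H)
  have h2 := mul_nonneg hξ (frobSq_nonneg (Y - W' * H))
  simp only [objective, codingObj]
  linarith

theorem TOSSolves.isArgmin_of_isTOSOutput {f : Matrix (Fin r) (Fin T) ℝ → ℝ} (hf : TOSSolves f K)
    {H : Matrix (Fin r) (Fin T) ℝ} (hH : IsTOSOutput f K H) : IsArgmin f (hardSet r K) H := by
  obtain ⟨y, H', G, γ, hrun, hlim⟩ := hH
  obtain ⟨H₁, hmin, hlim₁⟩ := (hf (y 0)).2 y H' G γ rfl hrun
  rwa [tendsto_nhds_unique hlim hlim₁]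

theorem TOSSolves.exists_isTOSOutput {f : Matrix (Fin r) (Fin T) ℝ → ℝ} (hf : TOSSolves f K) :
    ∃ H, IsTOSOutput f K H := by
  obtain ⟨y, H', G, γ, h0, hrun⟩ := (hf 0).1
  obtain ⟨H₁, -, hlim⟩ := (hf 0).2 y H' G γ h0 hrun
  exact ⟨H₁, y, H', G, γ, hrun, hlim⟩

theorem exists_isHardRun (X Y : Matrix (Fin d) (Fin T) ℝ) (K : Set (Fin T)) (hξ : 0 ≤ ξ)
    (hlam : 0 ≤ lam) (hmu : 0 ≤ mu) (hnu : 0 ≤ nu) (H₀ : Matrix (Fin r) (Fin T) ℝ)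
    (W₀ W₀' : Matrix (Fin d) (Fin r) ℝ) :
    ∃ (H : ℕ → Matrix (Fin r) (Fin T) ℝ) (W W' : ℕ → Matrix (Fin d) (Fin r) ℝ),
      H 0 = H₀ ∧ W 0 = W₀ ∧ W' 0 = W₀' ∧ IsHardRun X Y ξ lam mu nu K H W W' := by
  choose h hh using fun W W' : Matrix (Fin d) (Fin r) ℝ =>
    ((isLsqFun_codingObj X Y hξ hlam W W').tosSolves K).exists_isTOSOutput
  choose w hw using fun H : Matrix (Fin r) (Fin T) ℝ =>
    ((isLsqFun_frobSq_sub_mul_right X H).add (isLsqFun_frobSq.const_mul hmu)).exists_isArgmin_univ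
  choose w' hw' using fun H : Matrix (Fin r) (Fin T) ℝ =>
    (((isLsqFun_frobSq_sub_mul_right Y H).const_mul hξ).add
      (isLsqFun_frobSq.const_mul hnu)).exists_isArgmin_univ
  let next : Matrix (Fin r) (Fin T) ℝ × Matrix (Fin d) (Fin r) ℝ × Matrix (Fin d) (Fin r) ℝ →
      Matrix (Fin r) (Fin T) ℝ × Matrix (Fin d) (Fin r) ℝ × Matrix (Fin d) (Fin r) ℝ :=
    fun p => (h p.2.1 p.2.2, w (h p.2.1 p.2.2), w' (h p.2.1 p.2.2))
  let st := fun n : ℕ => next^[n] (H₀, W₀, W₀')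
  have hst : ∀ n, st (n + 1) = next (st n) := fun n => Function.iterate_succ_apply' _ _ _
  refine ⟨fun n => (st n).1, fun n => (st n).2.1, fun n => (st n).2.2, rfl, rfl, rfl,
    fun j => ?_, fun j => ?_, fun j => ?_⟩
  · rw [hst]
    exact hh _ _
  · rw [hst]
    exact hw _
  · rw [hst]
    exact hw' _

/-! ### Descent and cluster points of the alternating scheme -/

namespace IsHardRun

variable {H : ℕ → Matrix (Fin r) (Fin T) ℝ} {W W' : ℕ → Matrix (Fin d) (Fin r) ℝ}

theorem isArgmin_H (hrun : IsHardRun X Y ξ lam mu nu K H W W') (hξ : 0 ≤ ξ) (hlam : 0 ≤ lam)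
    (j : ℕ) : IsArgmin (codingObj X Y ξ lam (W j) (W' j)) (hardSet r K) (H (j + 1)) :=
  ((isLsqFun_codingObj X Y hξ hlam _ _).tosSolves K).isArgmin_of_isTOSOutput (hrun.H_update j)

theorem objective_le_of_weights (hrun : IsHardRun X Y ξ lam mu nu K H W W') (j : ℕ)
    (V V' : Matrix (Fin d) (Fin r) ℝ) :
    objective X Y ξ lam mu nu (H (j + 1)) (W (j + 1)) (W' (j + 1)) ≤
      objective X Y ξ lam mu nu (H (j + 1)) V V' := by
  have h1 := (hrun.W_update j).2 V trivial
  have h2 := (hrun.W'_update j).2 V' trivial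
  simp only [objective, codingObj] at h1 h2 ⊢
  linarith

theorem objective_succ_le (hrun : IsHardRun X Y ξ lam mu nu K H W W') (hξ : 0 ≤ ξ)
    (hlam : 0 ≤ lam) (j : ℕ) {H₁ : Matrix (Fin r) (Fin T) ℝ} (hH₁ : H₁ ∈ hardSet r K) :
    objective X Y ξ lam mu nu (H (j + 1)) (W (j + 1)) (W' (j + 1)) ≤
      objective X Y ξ lam mu nu H₁ (W j) (W' j) := by
  refine (hrun.objective_le_of_weights j (W j) (W' j)).trans ?_
  have h1 := (hrun.isArgmin_H hξ hlam j).2 H₁ hH₁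
  simp only [objective]
  linarith

theorem antitone_objective (hrun : IsHardRun X Y ξ lam mu nu K H W W') (hξ : 0 ≤ ξ)
    (hlam : 0 ≤ lam) :
    Antitone fun j => objective X Y ξ lam mu nu (H (j + 1)) (W (j + 1)) (W' (j + 1)) :=
  antitone_nat_of_succ_le fun j => hrun.objective_succ_le hξ hlam (j + 1)
    (hrun.isArgmin_H hξ hlam j).1

/-- The objective at a cluster point is the limit `l` of the decreasing values. Against any
competitor for one block, the block update gives an inequality with continuous sides that survives
in the limit; neither uniqueness nor continuity of the subproblem solutions is needed. -/
theorem isStationary_of_mapClusterPt (hrun : IsHardRun X Y ξ lam mu nu K H W W') (hξ : 0 ≤ ξ)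
    (hlam : 0 ≤ lam) (hmu : 0 ≤ mu) (hnu : 0 ≤ nu) {Hs : Matrix (Fin r) (Fin T) ℝ}
    {Ws Ws' : Matrix (Fin d) (Fin r) ℝ}
    (h : MapClusterPt (Hs, Ws, Ws') atTop fun j => (H j, W j, W' j)) :
    IsStationary X Y ξ lam mu nu K Hs Ws Ws' := by
  have hanti := hrun.antitone_objective hξ hlam
  have hbdd : BddBelow (Set.range fun j =>
      objective X Y ξ lam mu nu (H (j + 1)) (W (j + 1)) (W' (j + 1))) := by
    refine ⟨0, ?_⟩
    rintro _ ⟨j, rfl⟩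
    refine le_trans ?_ (weighted_frobSq_le_objective hξ _ _ _)
    have h1 := mul_nonneg hlam (frobSq_nonneg (H (j + 1)))
    have h2 := mul_nonneg hmu (frobSq_nonneg (W (j + 1)))
    have h3 := mul_nonneg hnu (frobSq_nonneg (W' (j + 1)))
    linarith
  have hlim := tendsto_atTop_ciInf hanti hbdd
  have hle := fun j => ciInf_le hbdd j
  set l := ⨅ j, objective X Y ξ lam mu nu (H (j + 1)) (W (j + 1)) (W' (j + 1))
  have hobj : Continuous fun p : Matrix (Fin r) (Fin T) ℝ × Matrix (Fin d) (Fin r) ℝ ×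
      Matrix (Fin d) (Fin r) ℝ => objective X Y ξ lam mu nu p.1 p.2.1 p.2.2 :=
    continuous_objective (by fun_prop) (by fun_prop) (by fun_prop)
  have hlim' : Tendsto (fun j => objective X Y ξ lam mu nu (H j) (W j) (W' j)) atTop (𝓝 l) :=
    (tendsto_add_atTop_iff_nat 1).1 hlim
  have hval : objective X Y ξ lam mu nu Hs Ws Ws' = l := by
    have h1 := h.continuousAt_comp hobj.continuousAt
    have h2 : (𝓝 (objective X Y ξ lam mu nu Hs Ws Ws') ⊓ 𝓝 l).NeBot :=
      NeBot.mono h1 (inf_le_inf_left _ hlim')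
    exact eq_of_nhds_neBot h2
  have hclosed : ∀ {S : Set (Matrix (Fin r) (Fin T) ℝ × Matrix (Fin d) (Fin r) ℝ ×
      Matrix (Fin d) (Fin r) ℝ)}, IsClosed S →
      (∀ j, (H (j + 1), W (j + 1), W' (j + 1)) ∈ S) → (Hs, Ws, Ws') ∈ S := by
    intro S hS hmem
    -- Membership is only required from index `1` on, since the initialization is arbitrary and may
    -- be infeasible.
    refine isClosed_iff_clusterPt.1 hS _ (ClusterPt.mono h (le_principal_iff.2 ?_))
    rw [mem_map]
    filter_upwards [eventually_ge_atTop 1] with j hj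
    obtain ⟨i, rfl⟩ := Nat.exists_eq_add_of_le' hj
    exact hmem i
  refine isStationary_of_block_min ?_ (fun H₁ hH₁ => ?_) (fun W₁ W₁' => ?_)
  · exact hclosed (isClosed_hardSet.preimage continuous_fst)
      fun j => (hrun.isArgmin_H hξ hlam j).1
  · rw [hval]
    -- The next iterate, minimized against `W (j + 1)` and `W' (j + 1)`, is no worse than `H₁` there
    -- and has value at least `l`.
    exact hclosed (S := {p | l ≤ objective X Y ξ lam mu nu H₁ p.2.1 p.2.2})
      (isClosed_le continuous_const
        (continuous_objective (by fun_prop) (by fun_prop) (by fun_prop)))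
      fun j => (hle (j + 1)).trans (hrun.objective_succ_le hξ hlam (j + 1) hH₁)
  · exact hclosed (S := {p | objective X Y ξ lam mu nu p.1 p.2.1 p.2.2 ≤
        objective X Y ξ lam mu nu p.1 W₁ W₁'})
      (isClosed_le hobj (continuous_objective (by fun_prop) (by fun_prop) (by fun_prop)))
      fun j => hrun.objective_le_of_weights j W₁ W₁'

theorem eventually_near_stationary (hrun : IsHardRun X Y ξ lam mu nu K H W W') (hξ : 0 ≤ ξ)
    (hlam : 0 ≤ lam) (hmu : 0 ≤ mu) (hnu : 0 ≤ nu) {C : ℝ}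
    (hC : ∀ j, frobSq (H j) + frobSq (W j) + frobSq (W' j) ≤ C) {ε : ℝ} (hε : 0 < ε) :
    ∀ᶠ j in atTop, ∃ (Hs : Matrix (Fin r) (Fin T) ℝ) (Ws Ws' : Matrix (Fin d) (Fin r) ℝ),
      IsStationary X Y ξ lam mu nu K Hs Ws Ws' ∧
        frobSq (H j - Hs) + frobSq (W j - Ws) + frobSq (W' j - Ws') < ε := by
  by_contra hcon
  rw [not_eventually] at hcon
  set B : Set ℕ := {j | ¬ ∃ (Hs : Matrix (Fin r) (Fin T) ℝ)
      (Ws Ws' : Matrix (Fin d) (Fin r) ℝ), IsStationary X Y ξ lam mu nu K Hs Ws Ws' ∧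
        frobSq (H j - Hs) + frobSq (W j - Ws) + frobSq (W' j - Ws') < ε}
  -- This filter plays the role of a subsequence of indices far from stationarity. By compactness it
  -- has a cluster point, which is stationary and near some of those indices.
  have hne : (atTop ⊓ 𝓟 B).NeBot := frequently_mem_iff_neBot.1 hcon
  have hball : ∀ {m n : Type} [Fintype m] [Fintype n] (M : Matrix m n ℝ), frobSq M ≤ C →
      M ∈ toEuc.symm '' Metric.closedBall (0 : EuclideanSpace ℝ (m × n)) √C := by
    intro m n _ _ M hM
    refine ⟨toEuc M, ?_, toEuc.symm_apply_apply M⟩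
    rw [mem_closedBall_zero_iff]
    exact Real.le_sqrt_of_sq_le (by rwa [← frobSq_eq_norm_sq])
  have hcomp : ∀ {m n : Type} [Fintype m] [Fintype n], IsCompact
      (toEuc.symm '' Metric.closedBall (0 : EuclideanSpace ℝ (m × n)) √C : Set (Matrix m n ℝ)) :=
    fun {_ _ _ _} => (isCompact_closedBall _ _).image continuous_toEuc_symm
  obtain ⟨⟨Hs, Ws, Ws'⟩, -, hp⟩ := (hcomp.prod (hcomp.prod hcomp)).exists_mapClusterPt_of_frequently
    (f := fun j => (H j, W j, W' j)) (l := atTop ⊓ 𝓟 B)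
    (Eventually.frequently (Eventually.of_forall fun j => by
      have h1 := frobSq_nonneg (H j)
      have h2 := frobSq_nonneg (W j)
      have h3 := frobSq_nonneg (W' j)
      have h4 := hC j
      exact ⟨hball _ (by linarith), hball _ (by linarith), hball _ (by linarith)⟩))
  have hstat := hrun.isStationary_of_mapClusterPt hξ hlam hmu hnu
    (ClusterPt.mono hp (map_mono inf_le_left))
  have hcont : Continuous fun q : Matrix (Fin r) (Fin T) ℝ × Matrix (Fin d) (Fin r) ℝ ×
      Matrix (Fin d) (Fin r) ℝ =>
      frobSq (q.1 - Hs) + frobSq (q.2.1 - Ws) + frobSq (q.2.2 - Ws') :=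
    ((continuous_frobSq.comp (by fun_prop)).add (continuous_frobSq.comp (by fun_prop))).add
      (continuous_frobSq.comp (by fun_prop))
  have hnear := hp.frequently ((hcont.tendsto (Hs, Ws, Ws')).eventually_lt_const (u := ε)
    (by simpa [frobSq] using hε))
  obtain ⟨j, hj1, hj2⟩ := (hnear.and_eventually (mem_inf_of_right (mem_principal_self _))).exists
  exact hj2 ⟨Hs, Ws, Ws', hstat, hj1⟩

theorem exists_bound (hrun : IsHardRun X Y ξ lam mu nu K H W W') (hξ : 0 ≤ ξ)
    (hlam : 0 < lam) (hmu : 0 < mu) (hnu : 0 < nu) :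
    ∃ C : ℝ, ∀ j, frobSq (H j) + frobSq (W j) + frobSq (W' j) ≤ C := by
  set M := objective X Y ξ lam mu nu (H 1) (W 1) (W' 1)
  set B := M / lam + M / mu + M / nu
  -- Descent starts at index `1`; the arbitrary initialization has to be bounded separately.
  refine ⟨max B (frobSq (H 0) + frobSq (W 0) + frobSq (W' 0)), fun j => ?_⟩
  rcases j with _ | j
  · exact le_max_right _ _
  · refine le_trans ?_ (le_max_left _ _)
    have h0 := (weighted_frobSq_le_objective hξ _ _ _).trans
      (hrun.antitone_objective hξ hlam.le (Nat.zero_le j))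
    have h1 := mul_nonneg hlam.le (frobSq_nonneg (H (j + 1)))
    have h2 := mul_nonneg hmu.le (frobSq_nonneg (W (j + 1)))
    have h3 := mul_nonneg hnu.le (frobSq_nonneg (W' (j + 1)))
    have h0' : lam * frobSq (H (j + 1)) + mu * frobSq (W (j + 1)) +
      nu * frobSq (W' (j + 1)) ≤ M := h0
    refine add_le_add (add_le_add ?_ ?_) ?_
    · rw [le_div_iff₀' hlam]; linarith
    · rw [le_div_iff₀' hmu]; linarith
    · rw [le_div_iff₀' hnu]; linarith

end IsHardRun

end Alternating

end SSNMF

theorem theorem2 (d r T Ttot : ℕ) (hT : T < Ttot)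
    (X : Matrix (Fin d) (Fin T) ℝ) (Yfull : Matrix (Fin d) (Fin Ttot) ℝ)
    (Y : Matrix (Fin d) (Fin T) ℝ) (hY : Y = Yfull.submatrix id (Fin.castLE hT.le))
    (K : Set (Fin T)) (Ktot : Set (Fin Ttot))
    (ξ lam mu nu : ℝ) (hξ : 0 ≤ ξ) (hlam : 0 ≤ lam) (hmu : 0 ≤ mu) (hnu : 0 ≤ nu) :
    -- every `H`-subproblem is solved by three operator splitting
    (∀ W W' : Matrix (Fin d) (Fin r) ℝ, SSNMF.TOSSolves (SSNMF.codingObj X Y ξ lam W W') K) ∧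
    -- so is the encoding problem over the whole period
    (∀ W' : Matrix (Fin d) (Fin r) ℝ,
      SSNMF.TOSSolves (fun H => SSNMF.frobSq (Yfull - W' * H)) Ktot) ∧
    -- the iterates exist from every initialization
    (∀ (H₀ : Matrix (Fin r) (Fin T) ℝ) (W₀ W₀' : Matrix (Fin d) (Fin r) ℝ),
      ∃ (H : ℕ → Matrix (Fin r) (Fin T) ℝ) (W W' : ℕ → Matrix (Fin d) (Fin r) ℝ),
        H 0 = H₀ ∧ W 0 = W₀ ∧ W' 0 = W₀' ∧ SSNMF.IsHardRun X Y ξ lam mu nu K H W W') ∧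
    ∀ (H : ℕ → Matrix (Fin r) (Fin T) ℝ) (W W' : ℕ → Matrix (Fin d) (Fin r) ℝ),
      SSNMF.IsHardRun X Y ξ lam mu nu K H W W' →
      -- every cluster point is stationary
      (∀ (Hs : Matrix (Fin r) (Fin T) ℝ) (Ws Ws' : Matrix (Fin d) (Fin r) ℝ),
        MapClusterPt (Hs, Ws, Ws') atTop (fun j => (H j, W j, W' j)) →
          SSNMF.IsStationary X Y ξ lam mu nu K Hs Ws Ws') ∧
      -- bounded iterates approach the set of stationary points
      ((∃ C : ℝ, ∀ j, SSNMF.frobSq (H j) + SSNMF.frobSq (W j) + SSNMF.frobSq (W' j) ≤ C) →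
        ∀ ε > 0, ∀ᶠ j in atTop,
          ∃ (Hs : Matrix (Fin r) (Fin T) ℝ) (Ws Ws' : Matrix (Fin d) (Fin r) ℝ),
            SSNMF.IsStationary X Y ξ lam mu nu K Hs Ws Ws' ∧
            SSNMF.frobSq (H j - Hs) + SSNMF.frobSq (W j - Ws) + SSNMF.frobSq (W' j - Ws') < ε) ∧
      -- with positive ridge weights the iterates are bounded
      (0 < lam → 0 < mu → 0 < nu →
        ∃ C : ℝ, ∀ j, SSNMF.frobSq (H j) + SSNMF.frobSq (W j) + SSNMF.frobSq (W' j) ≤ C) := by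
  refine ⟨fun W W' => (SSNMF.isLsqFun_codingObj X Y hξ hlam W W').tosSolves K,
    fun W' => (SSNMF.isLsqFun_frobSq_sub_mul Yfull W').tosSolves Ktot,
    SSNMF.exists_isHardRun X Y K hξ hlam hmu hnu,
    fun H W W' hrun => ⟨fun Hs Ws Ws' h => ?_, ?_, ?_⟩⟩
  · exact hrun.isStationary_of_mapClusterPt hξ hlam hmu hnu h
  · rintro ⟨C, hC⟩ ε hε
    exact hrun.eventually_near_stationary hξ hlam hmu hnu hC hε
  · exact fun h1 h2 h3 => hrun.exists_bound hξ h1 h2 h3
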